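/- Call a finite set $V\subset\mathbb R^d$ \emph{spanning} if its affine hull is $\mathbb R^d$. A convex polytope is the convex hull of a finite spanning set; a $d$-simplex is the convex hull of a spanning set of $d+1$ points (its vertices), and an open simplex is the interior of a $d$-simplex. A \emph{generalized polytope} is a finite union of convex polytopes in $\mathbb R^d$. A \emph{dissection} of a generalized polytope $\mathcal P$ is a finite collection of pairwise disjoint open $d$-simplices such that the closure of their union is $\mathcal P$. A point $v$ is a \emph{vertex} of $\mathcal P$ if every dissection of $\mathcal P$ contains an open simplex whose closure has $v$ as a vertex. The \emph{standard measure} of $\mathcal P$ is $\mu_{\mathcal P}=\chi_{\mathcal P}\,dx_1\cdots dx_d$. For a finite spanning set $S\subset\mathbb R^d$ with $N=|S|$, let $\mathcal P(S)$ be the set of all generalized polytopes all of whose vertices lie in $S$. Let $\mathfrak M(S)$ be the real linear span of the signed measures $\mu_{\mathcal P}$, $\mathcal P\in\mathcal P(S)$, and let $\mathfrak M^\Delta(S)\subseteq\mathfrak M(S)$ be the span of those $\mu_\Delta$ for which $\Delta\in\mathcal P(S)$ is a $d$-simplex. For $\mu\in\mathfrak M(S)$ put $$F_\mu(\mathbf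 u)=\sum_{I\in\mathbb Z_{\ge 0}^d}\frac{(|I|+d)!}{i_1!\cdots i_d!}\Big(\int_{\mathbb R^d}\mathbf x^I\,d\mu(\mathbf x)\Big)\mathbf u^I\in\mathbb R[[u_1,\dots,u_d]],$$ and let $\mathfrak F(S)$ and $\mathfrak F^\Delta(S)$ be the spaces of all $F_\mu$ with $\mu\in\mathfrak M(S)$ and $\mu\in\mathfrak M^\Delta(S)$, respectively. Let $\mathfrak{Rat}(S)$ be the space of all rational functions $P(\mathbf u)/\prod_{\mathbf v\in S}(1-\langle\mathbf v,\mathbf u\rangle)$ with $P$ a real polynomial of degree at most $N-d-1$. Suppose that $S$ is \emph{strongly non-degenerate}, that is, $S$ is spanning and every subset of $S$ with $d+1$ elements is spanning. Then $\mathfrak M^\Delta(S)=\mathfrak M(S)$, and each of the real vector spaces $\mathfrak M^\Delta(S)$, $\mathfrak M(S)$, $\mathfrak F^\Delta(S)$, $\mathfrak F(S)$ and $\mathfrak{Rat}(S)$ has dimension $\binom{N-1}{d}$. -/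

import Mathlib

open MeasureTheory

noncomputable section

namespace PolytopalMeasure

variable {d : ℕ}

/-- A finite set of points of `ℝ^d` is spanning if it is not contained in any proper affine
subspace of `ℝ^d`. -/
def IsSpanning (S : Finset (EuclideanSpace ℝ (Fin d))) : Prop :=
  affineSpan ℝ (S : Set (EuclideanSpace ℝ (Fin d))) = ⊤

/-- A finite spanning set is strongly non-degenerate if each of its subsets with `d + 1` elements
is spanning. -/
def StronglyNonDegenerate (S : Finset (EuclideanSpace ℝ (Fin d))) : Prop :=
  IsSpanning S ∧ ∀ V ⊆ S, V.card = d + 1 → IsSpanning V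

/-- A spanning set of `d + 1` points, that is, the vertex set of a `d`-simplex. -/
def IsSimplexVertexSet (V : Finset (EuclideanSpace ℝ (Fin d))) : Prop :=
  V.card = d + 1 ∧ IsSpanning V

/-- A `d`-simplex is the convex hull of a spanning set of `d + 1` points. -/
def IsSimplex (P : Set (EuclideanSpace ℝ (Fin d))) : Prop :=
  ∃ V : Finset (EuclideanSpace ℝ (Fin d)), IsSimplexVertexSet V ∧
    P = convexHull ℝ (V : Set (EuclideanSpace ℝ (Fin d)))

/-- A generalized polytope is a finite union of convex polytopes, where a convex polytope is the
convex hull of a finite spanning set. -/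
def IsGeneralizedPolytope (P : Set (EuclideanSpace ℝ (Fin d))) : Prop :=
  ∃ K : Finset (Finset (EuclideanSpace ℝ (Fin d))), (∀ V ∈ K, IsSpanning V) ∧
    P = ⋃ V ∈ K, convexHull ℝ (V : Set (EuclideanSpace ℝ (Fin d)))

/-- A dissection of `P` is a finite collection of pairwise disjoint open `d`-simplices, the closure
of whose union is `P`. An open simplex is the interior of a `d`-simplex, and it is recorded here by
the vertex set of that simplex (which it determines). -/
structure IsDissection (P : Set (EuclideanSpace ℝ (Fin d)))
    (T : Finset (Finset (EuclideanSpace ℝ (Fin d)))) : Prop where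
  simplex : ∀ V ∈ T, IsSimplexVertexSet V
  disjoint : ∀ V ∈ T, ∀ W ∈ T, V ≠ W →
    Disjoint (interior (convexHull ℝ (V : Set (EuclideanSpace ℝ (Fin d)))))
      (interior (convexHull ℝ (W : Set (EuclideanSpace ℝ (Fin d)))))
  closure_eq :
    closure (⋃ V ∈ T, interior (convexHull ℝ (V : Set (EuclideanSpace ℝ (Fin d))))) = P

/-- The vertices of a generalized polytope `P`: the points that are a vertex of (the closure of)
some open simplex in every dissection of `P`. -/
def vertices (P : Set (EuclideanSpace ℝ (Fin d))) : Set (EuclideanSpace ℝ (Fin d)) :=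
  {v | ∀ T, IsDissection P T → ∃ V ∈ T, v ∈ V}

/-- The set of all generalized polytopes whose vertices all belong to `S`. -/
def polytopes (S : Finset (EuclideanSpace ℝ (Fin d))) : Set (Set (EuclideanSpace ℝ (Fin d))) :=
  {P | IsGeneralizedPolytope P ∧ vertices P ⊆ S}

/-- The standard measure of `P`: Lebesgue measure with density the characteristic function of
`P`. -/
def standardMeasure (P : Set (EuclideanSpace ℝ (Fin d))) :
    SignedMeasure (EuclideanSpace ℝ (Fin d)) :=
  (volume : Measure (EuclideanSpace ℝ (Fin d))).withDensityᵥ (P.indicator fun _ => (1 : ℝ))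

/-- The space of polytopal measures with vertex set `S`: the real linear span of the standard
measures of all generalized polytopes with vertices in `S`. -/
def polytopalSpace (S : Finset (EuclideanSpace ℝ (Fin d))) :
    Submodule ℝ (SignedMeasure (EuclideanSpace ℝ (Fin d))) :=
  Submodule.span ℝ (standardMeasure '' polytopes S)

/-- The real linear span of the standard measures of all `d`-simplices with vertices in `S`. -/
def simplexSpace (S : Finset (EuclideanSpace ℝ (Fin d))) :
    Submodule ℝ (SignedMeasure (EuclideanSpace ℝ (Fin d))) :=
  Submodule.span ℝ (standardMeasure '' {P | P ∈ polytopes S ∧ IsSimplex P})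

theorem simplexSpace_le (S : Finset (EuclideanSpace ℝ (Fin d))) :
    simplexSpace S ≤ polytopalSpace S :=
  Submodule.span_mono (Set.image_mono fun _ h => h.1)

/-- The monomial `x ↦ x^I`. -/
def monomialFun (I : Fin d →₀ ℕ) (x : EuclideanSpace ℝ (Fin d)) : ℝ := ∏ k, x k ^ I k

/-- The moment `m_I(μ) = ∫ x^I dμ`. -/
def moment (μ : SignedMeasure (EuclideanSpace ℝ (Fin d))) (I : Fin d →₀ ℕ) : ℝ :=
  VectorMeasure.integral μ (monomialFun I) (ContinuousLinearMap.lsmul ℝ ℝ)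

/-- The normalized moment generating function (Fantappie transform) of `μ`,
`∑_I (|I| + d)! / (i_1! ⋯ i_d!) m_I(μ) u^I`. -/
def momentGenFun (μ : SignedMeasure (EuclideanSpace ℝ (Fin d))) : MvPowerSeries (Fin d) ℝ :=
  fun I => (((∑ k, I k) + d).factorial : ℝ) / (∏ k, ((I k).factorial : ℝ)) * moment μ I

theorem IsGeneralizedPolytope.isCompact {P : Set (EuclideanSpace ℝ (Fin d))}
    (hP : IsGeneralizedPolytope P) : IsCompact P := by
  obtain ⟨K, -, rfl⟩ := hP
  exact K.isCompact_biUnion fun V _ => V.finite_toSet.isCompact_convexHull ℝ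

theorem continuous_monomialFun (I : Fin d →₀ ℕ) :
    Continuous (monomialFun I) := by
  unfold monomialFun
  fun_prop

theorem integrable_standardMeasure {P : Set (EuclideanSpace ℝ (Fin d))}
    (hP : IsCompact P) (I : Fin d →₀ ℕ) : (standardMeasure P).Integrable (monomialFun I) := by
  have hint : Integrable (P.indicator fun _ => (1 : ℝ))
      (volume : Measure (EuclideanSpace ℝ (Fin d))) :=
    (integrable_indicator_iff hP.measurableSet).2
      (integrableOn_const hP.measure_lt_top.ne)
  have hd : (fun x => ‖P.indicator (fun _ => (1 : ℝ)) x‖ₑ)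
      = P.indicator (1 : EuclideanSpace ℝ (Fin d) → ENNReal) := by
    funext x
    by_cases hx : x ∈ P <;> simp [hx]
  unfold standardMeasure
  change MeasureTheory.Integrable _ _
  rw [Measure.variation_withDensityᵥ hint, hd, withDensity_indicator_one hP.measurableSet]
  exact (continuous_monomialFun I).continuousOn.integrableOn_compact hP

theorem integrable_of_mem {S : Finset (EuclideanSpace ℝ (Fin d))}
    {μ : SignedMeasure (EuclideanSpace ℝ (Fin d))} (hμ : μ ∈ polytopalSpace S)
    (I : Fin d →₀ ℕ) : μ.Integrable (monomialFun I) := by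
  induction hμ using Submodule.span_induction with
  | mem x hx =>
    obtain ⟨P, hP, rfl⟩ := hx
    exact integrable_standardMeasure hP.1.isCompact I
  | zero => exact VectorMeasure.Integrable.zero_vectorMeasure
  | add x y _ _ hx hy => exact hx.add_vectorMeasure hy
  | smul c x _ hx => exact hx.smul_vectorMeasure c

/-- The Fantappie transform, as a linear map on the space of polytopal measures. -/
def fantappie (S : Finset (EuclideanSpace ℝ (Fin d))) :
    polytopalSpace S →ₗ[ℝ] MvPowerSeries (Fin d) ℝ where
  toFun μ := momentGenFun μ.1
  map_add' μ ν := by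
    funext I
    change _ * moment (μ.1 + ν.1) I = _ * moment μ.1 I + _ * moment ν.1 I
    unfold moment
    rw [VectorMeasure.integral_add_vectorMeasure (integrable_of_mem μ.2 I)
      (integrable_of_mem ν.2 I), mul_add]
  map_smul' c μ := by
    funext I
    change _ * moment (c • μ.1) I = c * (_ * moment μ.1 I)
    unfold moment
    rw [VectorMeasure.integral_smul_vectorMeasure, smul_eq_mul]
    ring

/-- The space of Fantappie transforms of all polytopal measures with vertex set `S`. -/
def polytopalTransforms (S : Finset (EuclideanSpace ℝ (Fin d))) :
    Submodule ℝ (MvPowerSeries (Fin d) ℝ) :=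
  LinearMap.range (fantappie S)

/-- The space of Fantappie transforms of the linear combinations of standard measures of
`d`-simplices with vertices in `S`. -/
def simplexTransforms (S : Finset (EuclideanSpace ℝ (Fin d))) :
    Submodule ℝ (MvPowerSeries (Fin d) ℝ) :=
  LinearMap.range (fantappie S ∘ₗ Submodule.inclusion (simplexSpace_le S))

/-- The polynomial `Φ_S(u) = ∏_{v ∈ S} (1 - ⟨v, u⟩)`. -/
def denominator (S : Finset (EuclideanSpace ℝ (Fin d))) : MvPolynomial (Fin d) ℝ :=
  ∏ v ∈ S, (1 - ∑ k, MvPolynomial.C (v k) * MvPolynomial.X k)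

/-- The space of rational functions `P / Φ_S` with `P` a real polynomial of degree at most
`|S| - d - 1` (a spanning set has at least `d + 1` elements). -/
def rationalSpace (S : Finset (EuclideanSpace ℝ (Fin d))) :
    Submodule ℝ (FractionRing (MvPolynomial (Fin d) ℝ)) :=
  (MvPolynomial.restrictTotalDegree (Fin d) ℝ (S.card - (d + 1))).map
    (LinearMap.mulRight ℝ
        (algebraMap (MvPolynomial (Fin d) ℝ) (FractionRing (MvPolynomial (Fin d) ℝ))
          (denominator S))⁻¹ ∘ₗ
      (IsScalarTower.toAlgHom ℝ (MvPolynomial (Fin d) ℝ)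
        (FractionRing (MvPolynomial (Fin d) ℝ))).toLinearMap)

end PolytopalMeasure

end

open MeasureTheory
open scoped ENNReal

noncomputable section

namespace PolytopalMeasure

variable {d : ℕ}

/-! Write ℓ_v(a) = a₀ - ⟨v, a⟩. Integrating (a₀ - ⟨x, a⟩)^{-(d+1)} over a simplex with vertex set V
gives its volume divided by ∏_{v ∈ V} ℓ_v(a) (`IsSimplexVertexSet.integral_mul_prod`). Hence a
combination of simplices with vertices in A has a Cauchy transform with denominator ∏_{v ∈ A} ℓ_v
and numerator a form of degree |A| - d - 1 in d + 1 variables. A function of bounded support is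
determined by its moments, so the measure vanishes exactly when its numerator does
(`numerator_eq_zero_iff_simplexMeasure`). Linear algebra of measures thereby becomes linear algebra
of forms.

For strongly non-degenerate S and a fixed o ∈ S, the simplices with a vertex at o contribute
binom(N-1, d) products of linear forms. These are independent, and their number is the dimension of
all forms of degree N - d - 1, so every such form is a numerator
(`StronglyNonDegenerate.map_numerator`).

Let P be a generalized polytope with vertices in S, dissected with extra vertices, and let A contain
S and all of these. For v ∈ A \ S some other dissection avoids v. Comparing the two fractions shows
that ℓ_v divides the numerator over A, because the ℓ's are pairwise non-associated primes. After
cancelling all such ℓ_v, the numerator is a form of degree N - d - 1, hence comes from simplices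
with vertices in S (`StronglyNonDegenerate.standardMeasure_mem`). So both measure spaces are
isomorphic to this space of forms. The Fantappie transform is injective because it records all
moments, and the rational functions are counted directly. -/

/-! ### Homogenized affine forms and simplices in barycentric coordinates -/

/-- The homogenization `a₀ - ⟨x, (a₁, …, a_d)⟩` of the affine form `1 - ⟨x, u⟩`. -/
def pairing (a : Fin (d + 1) → ℝ) (x : EuclideanSpace ℝ (Fin d)) : ℝ :=
  a 0 - ∑ k, x k * a k.succ

/-- The linear form on `ℝ × ℝ^d` that restricts to `pairing a` on `{1} × ℝ^d`. -/
def conePairing (a : Fin (d + 1) → ℝ) (p : ℝ × EuclideanSpace ℝ (Fin d)) : ℝ :=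
  p.1 * a 0 - ∑ k, p.2 k * a k.succ

theorem continuous_pairing (a : Fin (d + 1) → ℝ) : Continuous (pairing a) := by
  unfold pairing; fun_prop

theorem continuous_conePairing (a : Fin (d + 1) → ℝ) : Continuous (conePairing a) := by
  unfold conePairing; fun_prop

theorem conePairing_smul (a : Fin (d + 1) → ℝ) (s : ℝ) (y : EuclideanSpace ℝ (Fin d)) :
    conePairing a (s, s • y) = s * pairing a y := by
  simp only [conePairing, pairing, mul_sub, Finset.mul_sum, PiLp.smul_apply, smul_eq_mul, mul_assoc]

theorem conePairing_sum {ι : Type*} (I : Finset ι) (a : Fin (d + 1) → ℝ) (t : ι → ℝ)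
    (v : ι → EuclideanSpace ℝ (Fin d)) :
    conePairing a (∑ i ∈ I, t i, ∑ i ∈ I, t i • v i) = ∑ i ∈ I, t i * pairing a (v i) := by
  simp only [conePairing, pairing, mul_sub, Finset.sum_sub_distrib, Finset.sum_mul, Finset.mul_sum,
    WithLp.ofLp_sum, WithLp.ofLp_smul, Finset.sum_apply, Pi.smul_apply, smul_eq_mul, mul_assoc]
  rw [Finset.sum_comm]

theorem pairing_single_zero (x : EuclideanSpace ℝ (Fin d)) :
    pairing (Pi.single 0 1) x = 1 := by
  simp [pairing]

theorem IsSimplexVertexSet.affineIndependent {V : Finset (EuclideanSpace ℝ (Fin d))}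
    (hV : IsSimplexVertexSet V) :
    AffineIndependent ℝ (Subtype.val : V → EuclideanSpace ℝ (Fin d)) := by
  rw [affineIndependent_iff_finrank_vectorSpan_eq ℝ _ (n := d) (by simpa using hV.1),
    ← direction_affineSpan, Subtype.range_coe_subtype]
  have h : affineSpan ℝ {x | x ∈ V} = ⊤ := hV.2
  rw [h, AffineSubspace.direction_top, finrank_top, finrank_euclideanSpace_fin]

/-- The vertices of a simplex as an affine basis. -/
def IsSimplexVertexSet.basis {V : Finset (EuclideanSpace ℝ (Fin d))}
    (hV : IsSimplexVertexSet V) : AffineBasis V ℝ (EuclideanSpace ℝ (Fin d)) :=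
  ⟨Subtype.val, hV.affineIndependent, by rw [Subtype.range_coe_subtype]; exact hV.2⟩

theorem IsSimplexVertexSet.basis_apply {V : Finset (EuclideanSpace ℝ (Fin d))}
    (hV : IsSimplexVertexSet V) (v : V) : hV.basis v = v := rfl

theorem IsSimplexVertexSet.interior_eq {V : Finset (EuclideanSpace ℝ (Fin d))}
    (hV : IsSimplexVertexSet V) :
    interior (convexHull ℝ (V : Set (EuclideanSpace ℝ (Fin d)))) =
      {x | ∀ v, 0 < hV.basis.coord v x} := by
  rw [← AffineBasis.interior_convexHull]
  congr 2
  change _ = Set.range (Subtype.val : V → _)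
  simp

/-! ### Cones over simplices and the simplex integral -/

/-- The linear map from `ℝ^V` onto `ℝ × ℝ^d` that sends the positive orthant to the cone over the
simplex with vertex set `V`. -/
def coneMap (V : Finset (EuclideanSpace ℝ (Fin d))) :
    (V → ℝ) →ₗ[ℝ] ℝ × EuclideanSpace ℝ (Fin d) :=
  Fintype.linearCombination ℝ fun v : V => ((1 : ℝ), (v : EuclideanSpace ℝ (Fin d)))

theorem coneMap_apply (V : Finset (EuclideanSpace ℝ (Fin d))) (t : V → ℝ) :
    coneMap V t = (∑ v, t v, ∑ v, t v • (v : EuclideanSpace ℝ (Fin d))) := by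
  simp [coneMap, Fintype.linearCombination_apply, Prod.ext_iff, Prod.fst_sum, Prod.snd_sum]

theorem IsSimplexVertexSet.coneMap_injective {V : Finset (EuclideanSpace ℝ (Fin d))}
    (hV : IsSimplexVertexSet V) : Function.Injective (coneMap V) := by
  refine (injective_iff_map_eq_zero _).2 fun t ht => ?_
  rw [coneMap_apply, Prod.mk_eq_zero] at ht
  funext v
  exact affineIndependent_iff.1 hV.affineIndependent Finset.univ t ht.1 ht.2 v (Finset.mem_univ v)

/-- The open cone over the simplex with vertex set `V`. -/
def openCone (V : Finset (EuclideanSpace ℝ (Fin d))) : Set (ℝ × EuclideanSpace ℝ (Fin d)) :=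
  {p | 0 < p.1 ∧ p.1⁻¹ • p.2 ∈ interior (convexHull ℝ (V : Set (EuclideanSpace ℝ (Fin d))))}

theorem measurableSet_openCone (V : Finset (EuclideanSpace ℝ (Fin d))) :
    MeasurableSet (openCone V) := by
  refine MeasurableSet.inter (measurableSet_lt measurable_const measurable_fst) ?_
  exact (measurable_fst.inv.smul measurable_snd) isOpen_interior.measurableSet

theorem measurable_indicator_openCone (V : Finset (EuclideanSpace ℝ (Fin d)))
    (a : Fin (d + 1) → ℝ) : Measurable ((openCone V).indicator
      (fun p => ENNReal.ofReal (Real.exp (-conePairing a p)))) :=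
  ((Real.continuous_exp.comp (continuous_conePairing a).neg).measurable.ennreal_ofReal).indicator
    (measurableSet_openCone V)

/-- Dividing `t` by its sum gives the barycentric coordinates of the point in question, and the
interior of a simplex is where all of these are positive. -/
theorem IsSimplexVertexSet.coneMap_mem_openCone {V : Finset (EuclideanSpace ℝ (Fin d))}
    (hV : IsSimplexVertexSet V) (t : V → ℝ) :
    coneMap V t ∈ openCone V ↔ ∀ v, 0 < t v := by
  have hne : Nonempty V := by
    have : V.Nonempty := Finset.card_pos.1 (by rw [hV.1]; omega)
    exact this.to_subtype
  have key : 0 < ∑ v, t v → ((∑ v, t v)⁻¹ • ∑ v, t v • (v : EuclideanSpace ℝ (Fin d)) ∈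
      interior (convexHull ℝ (V : Set (EuclideanSpace ℝ (Fin d)))) ↔ ∀ v, 0 < t v) := by
    intro hs
    have h1 : ∑ v, (∑ v, t v)⁻¹ * t v = 1 := by
      rw [← Finset.mul_sum, inv_mul_cancel₀ hs.ne']
    have h2 : (∑ v, t v)⁻¹ • ∑ v, t v • (v : EuclideanSpace ℝ (Fin d)) =
        Finset.affineCombination ℝ Finset.univ hV.basis (fun v => (∑ v, t v)⁻¹ * t v) := by
      rw [Finset.affineCombination_eq_linear_combination _ _ _ h1, Finset.smul_sum]
      simp [smul_smul, hV.basis_apply]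
    rw [hV.interior_eq, h2, Set.mem_ofPred_eq]
    refine forall_congr' fun v => ?_
    rw [AffineBasis.coord_apply_combination_of_mem _ (Finset.mem_univ v) h1]
    exact mul_pos_iff_of_pos_left (inv_pos.2 hs)
  rw [coneMap_apply]
  constructor
  · rintro ⟨h1, h2⟩
    exact (key h1).1 h2
  · intro h
    have h1 : 0 < ∑ v, t v := Finset.sum_pos (fun v _ => h v) Finset.univ_nonempty
    exact ⟨h1, (key h1).2 h⟩

/-- A linear isomorphism carries Haar measure to Haar measure. The Jacobian `c` can stay
unspecified, since it is recovered later from the volume of the simplex. -/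
theorem IsSimplexVertexSet.exists_lintegral_eq {V : Finset (EuclideanSpace ℝ (Fin d))}
    (hV : IsSimplexVertexSet V) :
    ∃ c : ℝ≥0∞, ∀ f : ℝ × EuclideanSpace ℝ (Fin d) → ℝ≥0∞, Measurable f →
      ∫⁻ p, f p = c * ∫⁻ t, f (coneMap V t) := by
  have hfin : Module.finrank ℝ (V → ℝ) = Module.finrank ℝ (ℝ × EuclideanSpace ℝ (Fin d)) := by
    simp [hV.1, add_comm]
  let L := (LinearMap.linearEquivOfInjective (coneMap V) hV.coneMap_injective
    hfin).toContinuousLinearEquiv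
  have hH : (Measure.map L (volume : Measure (V → ℝ))).IsAddHaarMeasure :=
    L.isAddHaarMeasure_map _
  have hP : (volume : Measure (ℝ × EuclideanSpace ℝ (Fin d))).IsAddHaarMeasure := by
    rw [Measure.volume_eq_prod]
    infer_instance
  have heq := Measure.isAddLeftInvariant_eq_smul
    (volume : Measure (ℝ × EuclideanSpace ℝ (Fin d))) (Measure.map L (volume : Measure (V → ℝ)))
  refine ⟨(Measure.addHaarScalarFactor (volume : Measure (ℝ × EuclideanSpace ℝ (Fin d)))
    (Measure.map L (volume : Measure (V → ℝ))) : NNReal), fun f hf => ?_⟩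
  conv_lhs => rw [heq]
  rw [lintegral_smul_measure, lintegral_map hf L.continuous.measurable]
  rfl

theorem lintegral_pow_mul_exp_neg (n : ℕ) {r : ℝ} (hr : 0 < r) :
    ∫⁻ s in Set.Ioi (0 : ℝ), ENNReal.ofReal (s ^ n * Real.exp (-(r * s))) =
      ENNReal.ofReal (n.factorial * (r ^ (n + 1))⁻¹) := by
  have h := Real.integral_rpow_mul_exp_neg_mul_Ioi (a := n + 1) (r := r) (by positivity) hr
  have h' : ∫ s in Set.Ioi (0 : ℝ), s ^ n * Real.exp (-(r * s)) =
      n.factorial * (r ^ (n + 1))⁻¹ := by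
    rw [Real.Gamma_nat_eq_factorial] at h
    simp only [add_sub_cancel_right, Real.rpow_natCast] at h
    rw [h, mul_comm, one_div, Real.inv_rpow hr.le]
    norm_cast
  rw [← h', ofReal_integral_eq_lintegral_ofReal]
  · refine Integrable.of_integral_ne_zero ?_
    rw [h']
    positivity
  · filter_upwards [ae_restrict_mem measurableSet_Ioi] with s hs
    have : (0 : ℝ) < s := hs
    positivity

/-- The exponential of a sum splits, so the integral is a product of one-dimensional ones. -/
theorem lintegral_orthant {ι : Type*} [Fintype ι] (r : ι → ℝ) (hr : ∀ i, 0 < r i) :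
    ∫⁻ t : ι → ℝ, Set.indicator {t | ∀ i, 0 < t i}
      (fun t => ENNReal.ofReal (Real.exp (-∑ i, t i * r i))) t =
      ENNReal.ofReal (∏ i, (r i)⁻¹) := by
  let g : ι → ℝ → ℝ := fun i => (Set.Ioi (0 : ℝ)).indicator fun s => Real.exp (-(r i) * s)
  have hg : ∀ i, Integrable (g i) := fun i =>
    (integrable_indicator_iff measurableSet_Ioi).2
      (integrableOn_exp_mul_Ioi (neg_neg_of_pos (hr i)) 0)
  have hg0 : ∀ i s, 0 ≤ g i s := fun i s => Set.indicator_nonneg (fun _ _ => (Real.exp_pos _).le) s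
  have hgi : ∀ i, ∫ s, g i s = (r i)⁻¹ := by
    intro i
    rw [integral_indicator measurableSet_Ioi, integral_exp_mul_Ioi (neg_neg_of_pos (hr i))]
    simp [neg_div_neg_eq]
  have h : ∀ t : ι → ℝ, Set.indicator {t | ∀ i, 0 < t i}
      (fun t => ENNReal.ofReal (Real.exp (-∑ i, t i * r i))) t =
      ENNReal.ofReal (∏ i, g i (t i)) := by
    intro t
    by_cases ht : ∀ i, 0 < t i
    · rw [Set.indicator_of_mem (by exact ht)]
      have : ∀ i, g i (t i) = Real.exp (-(r i) * t i) := fun i =>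
        Set.indicator_of_mem (by exact ht i) _
      simp only [this, ← Real.exp_sum, ← Finset.sum_neg_distrib]
      congr 2
      exact Finset.sum_congr rfl fun i _ => by ring
    · rw [Set.indicator_of_notMem (by exact ht)]
      push Not at ht
      obtain ⟨i, hi⟩ := ht
      rw [Finset.prod_eq_zero (Finset.mem_univ i), ENNReal.ofReal_zero]
      exact Set.indicator_of_notMem (by simpa using hi) _
  simp only [h]
  have hint : Integrable (fun t : ι → ℝ => ∏ i, g i (t i)) := Integrable.fintype_prod hg
  rw [← ofReal_integral_eq_lintegral_ofReal hint
    (Filter.Eventually.of_forall fun t => Finset.prod_nonneg fun i _ => hg0 i _),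
    integral_fintype_prod_volume_eq_prod]
  simp only [hgi]

/-- The slice of the cone at height s is s times the simplex. Substituting x = s y there produces
the factor s^d, and integrating over s first turns the exponential into a Gamma integral. -/
theorem lintegral_openCone (V : Finset (EuclideanSpace ℝ (Fin d))) (a : Fin (d + 1) → ℝ)
    (ha : ∀ x ∈ interior (convexHull ℝ (V : Set (EuclideanSpace ℝ (Fin d)))), 0 < pairing a x) :
    ∫⁻ p, (openCone V).indicator (fun p => ENNReal.ofReal (Real.exp (-conePairing a p))) p =
      ∫⁻ y in interior (convexHull ℝ (V : Set (EuclideanSpace ℝ (Fin d)))),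
        ENNReal.ofReal (d.factorial * (pairing a y ^ (d + 1))⁻¹) := by
  set K := interior (convexHull ℝ (V : Set (EuclideanSpace ℝ (Fin d)))) with hK
  have hKm : MeasurableSet K := isOpen_interior.measurableSet
  have hm := measurable_indicator_openCone V a
  have hinner : ∀ s, ∫⁻ x, (openCone V).indicator
        (fun p => ENNReal.ofReal (Real.exp (-conePairing a p))) (s, x) =
      (Set.Ioi (0 : ℝ)).indicator (fun s => ∫⁻ y in K,
        ENNReal.ofReal (s ^ d * Real.exp (-(pairing a y * s)))) s := by
    intro s
    by_cases hs : 0 < s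
    · rw [Set.indicator_of_mem (by exact hs)]
      have hmap := Measure.map_addHaar_smul
        (volume : Measure (EuclideanSpace ℝ (Fin d))) hs.ne'
      have h1 := lintegral_map (μ := (volume : Measure (EuclideanSpace ℝ (Fin d))))
        (hm.comp (measurable_prodMk_left (x := s))) (measurable_const_smul s)
      rw [hmap, lintegral_smul_measure, finrank_euclideanSpace_fin,
        abs_of_pos (by positivity)] at h1
      have h2 : ∫⁻ x, (openCone V).indicator
          (fun p => ENNReal.ofReal (Real.exp (-conePairing a p))) (s, x) =
          ENNReal.ofReal (s ^ d) * ∫⁻ y, (openCone V).indicator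
          (fun p => ENNReal.ofReal (Real.exp (-conePairing a p))) (s, s • y) := by
        refine Eq.trans ?_ (congrArg (ENNReal.ofReal (s ^ d) * ·) h1)
        rw [smul_eq_mul, ← mul_assoc, ← ENNReal.ofReal_mul (by positivity),
          mul_inv_cancel₀ (by positivity), ENNReal.ofReal_one, one_mul]
        rfl
      have hm' : Measurable fun y : EuclideanSpace ℝ (Fin d) => (openCone V).indicator
          (fun p => ENNReal.ofReal (Real.exp (-conePairing a p))) (s, s • y) :=
        hm.comp (by fun_prop)
      rw [h2, ← lintegral_const_mul _ hm', ← lintegral_indicator hKm]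
      refine lintegral_congr fun y => ?_
      by_cases hy : y ∈ K
      · rw [Set.indicator_of_mem hy, Set.indicator_of_mem, conePairing_smul,
          ENNReal.ofReal_mul (by positivity), mul_comm s]
        exact ⟨hs, by simpa [inv_smul_smul₀ hs.ne'] using hy⟩
      · rw [Set.indicator_of_notMem hy, Set.indicator_of_notMem, mul_zero]
        rintro ⟨-, h⟩
        exact hy (by simpa [inv_smul_smul₀ hs.ne'] using h)
    · rw [Set.indicator_of_notMem (by exact hs), lintegral_eq_zero_of_ae_eq_zero]
      refine Filter.Eventually.of_forall fun x => Set.indicator_of_notMem ?_ _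
      rintro ⟨h, -⟩
      exact hs h
  have hp := continuous_pairing a
  rw [Measure.volume_eq_prod, lintegral_prod _ hm.aemeasurable]
  simp only [hinner]
  rw [lintegral_indicator measurableSet_Ioi, lintegral_lintegral_swap]
  · refine setLIntegral_congr_fun hKm fun y hy => ?_
    exact lintegral_pow_mul_exp_neg d (ha y hy)
  · refine (Continuous.measurable ?_).ennreal_ofReal.aemeasurable
    fun_prop

theorem pairing_pos_of_mem_convexHull {V : Finset (EuclideanSpace ℝ (Fin d))}
    {a : Fin (d + 1) → ℝ} (ha : ∀ v ∈ V, 0 < pairing a v) {x : EuclideanSpace ℝ (Fin d)}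
    (hx : x ∈ convexHull ℝ (V : Set (EuclideanSpace ℝ (Fin d)))) : 0 < pairing a x := by
  have hc : Convex ℝ {x : EuclideanSpace ℝ (Fin d) | 0 < pairing a x} := by
    have : IsLinearMap ℝ fun x : EuclideanSpace ℝ (Fin d) => ∑ k, x k * a k.succ :=
      ⟨fun x y => by simp [add_mul, Finset.sum_add_distrib],
        fun c x => by simp [Finset.mul_sum, mul_assoc]⟩
    simpa only [pairing, sub_pos] using convex_halfSpace_lt this (a 0)
  exact convexHull_min (fun v hv => ha v hv) hc hx

theorem volume_interior_convexHull_ne_top (V : Finset (EuclideanSpace ℝ (Fin d))) :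
    volume (interior (convexHull ℝ (V : Set (EuclideanSpace ℝ (Fin d))))) ≠ ∞ :=
  ((measure_mono interior_subset).trans_lt
    (V.finite_toSet.isCompact_convexHull ℝ).measure_lt_top).ne

theorem IsSimplexVertexSet.volume_pos {V : Finset (EuclideanSpace ℝ (Fin d))}
    (hV : IsSimplexVertexSet V) :
    0 < volume.real (interior (convexHull ℝ (V : Set (EuclideanSpace ℝ (Fin d))))) := by
  refine ENNReal.toReal_pos ?_ (volume_interior_convexHull_ne_top V)
  exact (isOpen_interior.measure_pos volume
    (interior_convexHull_nonempty_iff_affineSpan_eq_top.2 hV.2)).ne'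

/-- The integral of `(a₀ - ⟨x, a⟩)^{-(d+1)}` over a simplex. -/
theorem IsSimplexVertexSet.integral_mul_prod {V : Finset (EuclideanSpace ℝ (Fin d))}
    (hV : IsSimplexVertexSet V) {a : Fin (d + 1) → ℝ} (ha : ∀ v ∈ V, 0 < pairing a v) :
    (∫ x in interior (convexHull ℝ (V : Set (EuclideanSpace ℝ (Fin d)))),
      (pairing a x ^ (d + 1))⁻¹) * ∏ v ∈ V, pairing a v =
      volume.real (interior (convexHull ℝ (V : Set (EuclideanSpace ℝ (Fin d))))) := by
  obtain ⟨c, hc⟩ := hV.exists_lintegral_eq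
  have hm := measurable_indicator_openCone V
  have key : ∀ a : Fin (d + 1) → ℝ, (∀ v ∈ V, 0 < pairing a v) →
      ∫⁻ y in interior (convexHull ℝ (V : Set (EuclideanSpace ℝ (Fin d)))),
        ENNReal.ofReal (d.factorial * (pairing a y ^ (d + 1))⁻¹) =
      c * ENNReal.ofReal (∏ v ∈ V, (pairing a v)⁻¹) := by
    intro a ha
    rw [← lintegral_openCone V a fun x hx => pairing_pos_of_mem_convexHull ha (interior_subset hx),
      hc _ (hm a), ← Finset.prod_coe_sort,
      ← lintegral_orthant (fun v : V => pairing a v) fun v => ha v v.2]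
    congr 2
    funext t
    by_cases ht : ∀ v, 0 < t v
    · rw [Set.indicator_of_mem ((hV.coneMap_mem_openCone t).2 ht),
        Set.indicator_of_mem (by exact ht), coneMap_apply, conePairing_sum]
    · rw [Set.indicator_of_notMem (fun h => ht ((hV.coneMap_mem_openCone t).1 h)),
        Set.indicator_of_notMem (by exact ht)]
  -- At a = (1, 0, …, 0) every pairing is 1, which identifies `c` as d! times the volume.
  have hvol := key (Pi.single 0 1) fun v _ => by simp [pairing_single_zero]
  simp only [pairing_single_zero, one_pow, inv_one, mul_one, Finset.prod_const_one,
    ENNReal.ofReal_one, lintegral_const, Measure.restrict_apply_univ] at hvol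
  have hpos : ∀ x ∈ interior (convexHull ℝ (V : Set (EuclideanSpace ℝ (Fin d)))),
      0 < pairing a x := fun x hx => pairing_pos_of_mem_convexHull ha (interior_subset hx)
  have hprod : 0 < ∏ v ∈ V, pairing a v := Finset.prod_pos ha
  have h := key a ha
  rw [← hvol] at h
  have hI : d.factorial * ∫ x in interior (convexHull ℝ (V : Set (EuclideanSpace ℝ (Fin d)))),
      (pairing a x ^ (d + 1))⁻¹ =
      d.factorial * volume.real (interior (convexHull ℝ (V : Set (EuclideanSpace ℝ (Fin d))))) *
        ∏ v ∈ V, (pairing a v)⁻¹ := by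
    rw [← integral_const_mul, integral_eq_lintegral_of_nonneg_ae, h, ENNReal.toReal_mul,
      ENNReal.toReal_mul, ENNReal.toReal_ofReal (by positivity),
      ENNReal.toReal_ofReal (Finset.prod_nonneg fun v hv => (inv_pos.2 (ha v hv)).le)]
    · rfl
    · filter_upwards [ae_restrict_mem isOpen_interior.measurableSet] with x hx
      have := hpos x hx
      positivity
    · have hp := (continuous_pairing a).measurable
      exact Measurable.aestronglyMeasurable (by fun_prop)
  rw [mul_assoc] at hI
  rw [mul_left_cancel₀ (by positivity) hI, Finset.prod_inv_distrib, mul_assoc,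
    inv_mul_cancel₀ hprod.ne', mul_one]

/-! ### Moments and Cauchy transforms determine a function -/

theorem charFun_withDensity_ofReal {f : EuclideanSpace ℝ (Fin d) → ℝ} (hf : Measurable f)
    (t : EuclideanSpace ℝ (Fin d)) :
    charFun (volume.withDensity fun x => ENNReal.ofReal (f x)) t =
      ∫ x, ((max (f x) 0 : ℝ) : ℂ) * Complex.exp ((inner ℝ x t : ℝ) * Complex.I) := by
  rw [charFun_apply, integral_withDensity_eq_integral_toReal_smul hf.ennreal_ofReal
    (Filter.Eventually.of_forall fun x => ENNReal.ofReal_lt_top)]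
  refine integral_congr_ae (Filter.Eventually.of_forall fun x => ?_)
  simp [ENNReal.toReal_ofReal']

/-- The positive and negative parts of `f` are densities of two finite measures with the same
characteristic function, so the measures coincide. -/
theorem ae_eq_zero_of_forall_integral_exp {f : EuclideanSpace ℝ (Fin d) → ℝ} (hm : Measurable f)
    (hf : Integrable f)
    (h : ∀ t, ∫ x, (f x : ℂ) * Complex.exp ((inner ℝ x t : ℝ) * Complex.I) = 0) :
    f =ᵐ[volume] 0 := by
  have hfin : IsFiniteMeasure (volume.withDensity fun x => ENNReal.ofReal (f x)) :=
    isFiniteMeasure_withDensity_ofReal hf.2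
  have hfin' : IsFiniteMeasure (volume.withDensity fun x => ENNReal.ofReal (-f x)) :=
    isFiniteMeasure_withDensity_ofReal hf.neg.2
  have hexp : ∀ t, Continuous fun x : EuclideanSpace ℝ (Fin d) =>
      Complex.exp ((inner ℝ x t : ℝ) * Complex.I) := fun t => by fun_prop
  have hint : ∀ g : EuclideanSpace ℝ (Fin d) → ℝ, Integrable g → ∀ t,
      Integrable fun x => (g x : ℂ) * Complex.exp ((inner ℝ x t : ℝ) * Complex.I) := by
    intro g hg t
    refine hg.ofReal.mul_bdd (c := 1) (hexp t).aestronglyMeasurable ?_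
    exact Filter.Eventually.of_forall fun x => (Complex.norm_exp_ofReal_mul_I _).le
  have hmeas : volume.withDensity (fun x => ENNReal.ofReal (f x)) =
      volume.withDensity fun x => ENNReal.ofReal (-f x) := by
    refine Measure.ext_of_charFun (funext fun t => ?_)
    rw [charFun_withDensity_ofReal hm, charFun_withDensity_ofReal (f := fun x => -f x) hm.neg,
      ← sub_eq_zero,
      ← integral_sub (hint _ hf.pos_part t) (hint _ hf.neg_part t), ← h t]
    refine integral_congr_ae (Filter.Eventually.of_forall fun x => ?_)
    beta_reduce
    rw [← sub_mul, ← Complex.ofReal_sub]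
    congr 2
    rcases le_total (f x) 0 with h0 | h0 <;> simp [h0]
  refine hf.ae_eq_of_withDensityᵥ_eq (integrable_zero _ _ _) ?_
  rw [withDensityᵥ_eq_withDensity_pos_part_sub_withDensity_neg_part hf, withDensityᵥ_zero,
    sub_eq_zero]
  ext s hs
  simp only [Measure.toSignedMeasure_apply_measurable hs, hmeas, measureReal_def]

theorem norm_inner_le_of_ne_zero {f : EuclideanSpace ℝ (Fin d) → ℝ} {R : ℝ}
    (hR : ∀ x, R < ‖x‖ → f x = 0) {x : EuclideanSpace ℝ (Fin d)} (hx : f x ≠ 0)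
    (u : EuclideanSpace ℝ (Fin d)) : |inner ℝ x u| ≤ R * ‖u‖ :=
  (abs_real_inner_le_norm x u).trans
    (mul_le_mul_of_nonneg_right (not_lt.1 fun h => hx (hR x h)) (norm_nonneg u))

/-- An integrable function of bounded support all of whose moments vanish is zero. -/
theorem ae_eq_zero_of_forall_integral_inner_pow {f : EuclideanSpace ℝ (Fin d) → ℝ}
    (hm : Measurable f) (hf : Integrable f) {R : ℝ} (hR : ∀ x, R < ‖x‖ → f x = 0)
    (h : ∀ (u : EuclideanSpace ℝ (Fin d)) (k : ℕ), ∫ x, f x * inner ℝ x u ^ k = 0) :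
    f =ᵐ[volume] 0 := by
  refine ae_eq_zero_of_forall_integral_exp hm hf fun t => ?_
  -- The terms of the exponential series times `f`. Bounded support dominates them by (R‖t‖)^k / k!,
  -- so integral and sum may be exchanged.
  let F : ℕ → EuclideanSpace ℝ (Fin d) → ℂ := fun k x =>
    (Complex.I ^ k / k.factorial) * ((f x * inner ℝ x t ^ k : ℝ) : ℂ)
  have hbound : ∀ k x, ‖F k x‖ ≤ ((R * ‖t‖) ^ k / k.factorial) * ‖f x‖ := by
    intro k x
    by_cases hx : f x = 0
    · simp [F, hx]
    · have h1 := norm_inner_le_of_ne_zero hR hx t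
      simp only [F, norm_mul, norm_div, norm_pow, Complex.norm_I, one_pow, Complex.norm_real,
        Complex.norm_natCast, Real.norm_eq_abs]
      rw [mul_left_comm, mul_comm, one_div, div_eq_inv_mul]
      gcongr
  have hFm : ∀ k, AEStronglyMeasurable (F k) volume := fun k => by
    have : Continuous fun x : EuclideanSpace ℝ (Fin d) => inner ℝ x t ^ k := by fun_prop
    have h2 := hm.mul this.measurable
    exact (measurable_const.mul (Complex.measurable_ofReal.comp h2)).aestronglyMeasurable
  have hFi : ∀ k, Integrable (F k) := fun k =>
    (hf.norm.const_mul _).mono' (hFm k) (Filter.Eventually.of_forall (hbound k))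
  have hsum := hasSum_integral_of_summable_integral_norm hFi <| by
    refine Summable.of_nonneg_of_le (fun k => integral_nonneg fun x => norm_nonneg _)
      (fun k => integral_mono (hFi k).norm (hf.norm.const_mul _) (hbound k)) ?_
    simp only [integral_const_mul]
    exact (Real.summable_pow_div_factorial _).mul_right _
  have h0 : ∀ k, ∫ x, F k x = 0 := by
    intro k
    simp only [F]
    rw [integral_const_mul, integral_complex_ofReal, h t k, Complex.ofReal_zero, mul_zero]
  simp only [h0] at hsum
  rw [← hsum.unique hasSum_zero]
  refine integral_congr_ae (Filter.Eventually.of_forall fun x => ?_)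
  have hexp := (NormedSpace.expSeries_div_hasSum_exp
    ((inner ℝ x t : ℝ) * Complex.I : ℂ)).mul_left (f x : ℂ)
  rw [← Complex.exp_eq_exp_ℂ] at hexp
  refine hexp.tsum_eq.symm.trans ?_
  refine tsum_congr fun k => ?_
  simp only [F]
  push_cast
  ring

/-- The integral of `f(x) (a₀ - ⟨x, a⟩)^{-(d+1)}`. -/
def cauchyTransform (f : EuclideanSpace ℝ (Fin d) → ℝ) (a : Fin (d + 1) → ℝ) : ℝ :=
  ∫ x, f x * (pairing a x ^ (d + 1))⁻¹

/-- The binomial series of (1 - s⟨x, u⟩)^{-(d+1)} has coefficients binom(k+d, d)⟨x, u⟩^k. Integrated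
termwise, it becomes a power series in s that vanishes near 0, so each coefficient is zero. The
bound `hu` makes the series converge on the support of `f`. -/
theorem integral_inner_pow_eq_zero {f : EuclideanSpace ℝ (Fin d) → ℝ} (hm : Measurable f)
    (hf : Integrable f) {R : ℝ} (hR0 : 0 ≤ R) (hR : ∀ x, R < ‖x‖ → f x = 0)
    {u : EuclideanSpace ℝ (Fin d)} (hu : R * ‖u‖ < 1)
    (h : ∀ s : ℝ, |s| < 1 → ∫ x, f x * ((1 - s * inner ℝ x u) ^ (d + 1))⁻¹ = 0) (k : ℕ) :
    ∫ x, f x * inner ℝ x u ^ k = 0 := by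
  let c : ℕ → ℝ := fun k => (k + d).choose d * ∫ x, f x * inner ℝ x u ^ k
  have hq0 : 0 ≤ R * ‖u‖ := by positivity
  have key : ∀ s : ℝ, |s| < 1 → HasSum (fun k => s ^ k * c k) 0 := by
    intro s hs
    let F : ℕ → EuclideanSpace ℝ (Fin d) → ℝ := fun k x =>
      (s ^ k * (k + d).choose d) * (f x * inner ℝ x u ^ k)
    have hbound : ∀ k x, ‖F k x‖ ≤ ((k + d).choose d * (R * ‖u‖) ^ k) * ‖f x‖ := by
      intro k x
      by_cases hx : f x = 0
      · simp [F, hx]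
      · have h1 := norm_inner_le_of_ne_zero hR hx u
        simp only [F, norm_mul, norm_pow, Real.norm_eq_abs, Nat.abs_cast]
        calc |s| ^ k * ((k + d).choose d : ℝ) * (|f x| * |inner ℝ x u| ^ k)
            ≤ 1 * ((k + d).choose d : ℝ) * (|f x| * (R * ‖u‖) ^ k) := by
              gcongr
              exact pow_le_one₀ (abs_nonneg s) hs.le
          _ = _ := by ring
    have hFm : ∀ k, AEStronglyMeasurable (F k) volume := fun k => by
      have : Continuous fun x : EuclideanSpace ℝ (Fin d) => inner ℝ x u ^ k := by fun_prop
      exact (measurable_const.mul (hm.mul this.measurable)).aestronglyMeasurable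
    have hFi : ∀ k, Integrable (F k) := fun k =>
      (hf.norm.const_mul _).mono' (hFm k) (Filter.Eventually.of_forall (hbound k))
    have hsum := hasSum_integral_of_summable_integral_norm hFi <| by
      refine Summable.of_nonneg_of_le (fun k => integral_nonneg fun x => norm_nonneg _)
        (fun k => integral_mono (hFi k).norm (hf.norm.const_mul _) (hbound k)) ?_
      simp only [integral_const_mul]
      have hq : ‖R * ‖u‖‖ < 1 := by rwa [Real.norm_of_nonneg hq0]
      exact (hasSum_choose_mul_geometric_of_norm_lt_one (𝕜 := ℝ) d hq).summable.mul_right _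
    have hval : ∫ x, ∑' k, F k x = 0 := by
      rw [← h s hs]
      refine integral_congr_ae (Filter.Eventually.of_forall fun x => ?_)
      change ∑' k, F k x = f x * ((1 - s * inner ℝ x u) ^ (d + 1))⁻¹
      by_cases hx : f x = 0
      · simp [F, hx]
      · have h1 := norm_inner_le_of_ne_zero hR hx u
        have h2 : ‖s * inner ℝ x u‖ < 1 := by
          rw [norm_mul, Real.norm_eq_abs, Real.norm_eq_abs]
          calc |s| * |inner ℝ x u| ≤ 1 * (R * ‖u‖) := by gcongr
            _ < 1 := by rwa [one_mul]
        rw [← one_div, ← ((hasSum_choose_mul_geometric_of_norm_lt_one d h2).mul_left (f x)).tsum_eq]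
        refine tsum_congr fun k => ?_
        simp only [F, mul_pow]
        ring
    rw [hval] at hsum
    have hFc : (fun k => ∫ x, F k x) = fun k => s ^ k * c k := by
      funext k
      simp only [F, c]
      rw [integral_const_mul, mul_assoc]
    rwa [hFc] at hsum
  have hp : HasFPowerSeriesAt (0 : ℝ → ℝ) (FormalMultilinearSeries.ofScalars ℝ c) 0 := by
    rw [hasFPowerSeriesAt_iff]
    filter_upwards [Metric.ball_mem_nhds (0 : ℝ) one_pos] with s hs
    simpa [FormalMultilinearSeries.coeff_ofScalars] using
      key s (by simpa [Real.dist_eq] using hs)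
  have hc : c k = 0 := by
    rw [← FormalMultilinearSeries.coeff_ofScalars (𝕜 := ℝ) (p := c) (n := k), hp.eq_zero]
    rfl
  refine (mul_eq_zero.1 hc).resolve_left ?_
  exact_mod_cast (Nat.choose_pos (Nat.le_add_left d k)).ne'

/-- An integrable function of bounded support whose Cauchy transform vanishes is zero. -/
theorem ae_eq_zero_of_cauchyTransform {f : EuclideanSpace ℝ (Fin d) → ℝ} (hm : Measurable f)
    (hf : Integrable f) {R : ℝ} (hR0 : 0 ≤ R) (hR : ∀ x, R < ‖x‖ → f x = 0)
    (h : ∀ a, (∀ x, ‖x‖ ≤ R → 0 < pairing a x) → cauchyTransform f a = 0) :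
    f =ᵐ[volume] 0 := by
  refine ae_eq_zero_of_forall_integral_inner_pow hm hf hR fun u k => ?_
  -- Shrinking `u` by this factor reaches the domain of convergence. The k-th moment only changes by
  -- the k-th power of the factor.
  have hc : 0 < (R * ‖u‖ + 1)⁻¹ := by positivity
  have hu : R * ‖(R * ‖u‖ + 1)⁻¹ • u‖ < 1 := by
    rw [norm_smul, Real.norm_of_nonneg hc.le, mul_left_comm, ← div_eq_inv_mul,
      div_lt_one (by positivity)]
    exact lt_add_one _
  have h1 := integral_inner_pow_eq_zero hm hf hR0 hR hu (fun s hs => ?_) k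
  · simp only [inner_smul_right, mul_pow, mul_left_comm (f _), integral_const_mul] at h1
    exact (mul_eq_zero.1 h1).resolve_left (by positivity)
  · set w := (R * ‖u‖ + 1)⁻¹ • u
    have hpair : ∀ x, pairing (Fin.cons 1 fun k => s * w k : Fin (d + 1) → ℝ) x =
        1 - s * inner ℝ x w := by
      intro x
      simp only [pairing, Fin.cons_zero, Fin.cons_succ, PiLp.inner_apply, Finset.mul_sum]
      congr 1
      refine Finset.sum_congr rfl fun k _ => ?_
      simp
      ring
    rw [← h (Fin.cons 1 fun k => s * w k)]
    · simp only [cauchyTransform, hpair]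
    · intro x hx
      rw [hpair, sub_pos]
      refine (le_abs_self _).trans_lt ?_
      rw [abs_mul]
      calc |s| * |inner ℝ x w| ≤ 1 * (‖x‖ * ‖w‖) := by
            gcongr
            exact abs_real_inner_le_norm x w
        _ ≤ R * ‖w‖ := by rw [one_mul]; gcongr
        _ < 1 := hu

/-! ### Linear forms, divisibility and dimensions of spaces of polynomials -/

section Polynomials

open MvPolynomial

/-- The linear form `a ↦ a₀ - ⟨v, a⟩`, as a polynomial. -/
def linForm (v : EuclideanSpace ℝ (Fin d)) : MvPolynomial (Fin (d + 1)) ℝ :=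
  X 0 - ∑ k, C (v k) * X (Fin.succ k)

/-- The product of the linear forms attached to the points of `A`. -/
def linFormProd (A : Finset (EuclideanSpace ℝ (Fin d))) : MvPolynomial (Fin (d + 1)) ℝ :=
  ∏ v ∈ A, linForm v

theorem eval_linForm (a : Fin (d + 1) → ℝ) (v : EuclideanSpace ℝ (Fin d)) :
    eval a (linForm v) = pairing a v := by
  simp [linForm, pairing]

theorem eval_linFormProd (a : Fin (d + 1) → ℝ) (A : Finset (EuclideanSpace ℝ (Fin d))) :
    eval a (linFormProd A) = ∏ v ∈ A, pairing a v := by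
  simp [linFormProd, eval_linForm]

theorem linForm_ne_zero (v : EuclideanSpace ℝ (Fin d)) : linForm v ≠ 0 := by
  intro h
  have := eval_linForm (Pi.single 0 1) v
  rw [h, pairing_single_zero, map_zero] at this
  exact zero_ne_one this

theorem isHomogeneous_linForm (v : EuclideanSpace ℝ (Fin d)) : (linForm v).IsHomogeneous 1 :=
  (isHomogeneous_X ℝ 0).sub (IsHomogeneous.sum _ _ _ fun _ _ => isHomogeneous_C_mul_X _ _)

theorem isHomogeneous_linFormProd (A : Finset (EuclideanSpace ℝ (Fin d))) :
    (linFormProd A).IsHomogeneous A.card := by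
  simpa [linFormProd] using IsHomogeneous.prod A linForm (fun _ => 1)
    fun v _ => isHomogeneous_linForm v

theorem irreducible_linForm (v : EuclideanSpace ℝ (Fin d)) : Irreducible (linForm v) := by
  refine irreducible_of_totalDegree_eq_one
    ((isHomogeneous_linForm v).totalDegree (linForm_ne_zero v)) fun x hx => ?_
  refine isUnit_iff_ne_zero.2 fun h0 => linForm_ne_zero v ?_
  ext i
  simpa [h0] using hx i

theorem prime_linForm (v : EuclideanSpace ℝ (Fin d)) : Prime (linForm v) :=
  (irreducible_linForm v).prime

theorem linForm_not_dvd {v w : EuclideanSpace ℝ (Fin d)} (h : v ≠ w) :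
    ¬ linForm v ∣ linForm w := by
  rintro ⟨c, hc⟩
  -- A zero of ℓ_v at which ℓ_w takes the value ‖v - w‖².
  let a : Fin (d + 1) → ℝ := Fin.cons (∑ k, v k * (v k - w k)) fun k => v k - w k
  have hv : pairing a v = 0 := by simp [pairing, a]
  have hw := congrArg (eval a) hc
  rw [map_mul, eval_linForm, eval_linForm, hv, zero_mul] at hw
  have hw' : ∑ k, (v k - w k) * (v k - w k) = 0 := by
    simpa only [pairing, a, Fin.cons_zero, Fin.cons_succ, ← Finset.sum_sub_distrib, ← sub_mul]
      using hw
  rw [Finset.sum_eq_zero_iff_of_nonneg fun k _ => mul_self_nonneg _] at hw'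
  refine h (PiLp.ext fun k => ?_)
  exact sub_eq_zero.1 (mul_self_eq_zero.1 (hw' k (Finset.mem_univ k)))

theorem linForm_not_dvd_linFormProd {v : EuclideanSpace ℝ (Fin d)}
    {A : Finset (EuclideanSpace ℝ (Fin d))} (h : v ∉ A) : ¬ linForm v ∣ linFormProd A := by
  rw [linFormProd, (prime_linForm v).dvd_finsetProd_iff]
  rintro ⟨w, hw, hd⟩
  exact linForm_not_dvd (ne_of_mem_of_not_mem hw h).symm hd

theorem linFormProd_dvd {A : Finset (EuclideanSpace ℝ (Fin d))}
    {p : MvPolynomial (Fin (d + 1)) ℝ} (h : ∀ v ∈ A, linForm v ∣ p) : linFormProd A ∣ p := by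
  refine Finset.prod_dvd_of_isRelPrime (fun v _ w _ hvw => ?_) h
  exact (irreducible_linForm v).isRelPrime_iff_not_dvd.2 (linForm_not_dvd hvw)

/-- Only the degree-`n` component of the cofactor contributes to degree `m + n` of the product, so
the other components can be discarded. -/
theorem exists_isHomogeneous_of_dvd {σ : Type*} {q p : MvPolynomial σ ℝ} {m n : ℕ}
    (hq : q.IsHomogeneous m) (hp : p.IsHomogeneous (m + n)) (h : q ∣ p) :
    ∃ r : MvPolynomial σ ℝ, r.IsHomogeneous n ∧ p = q * r := by
  obtain ⟨c, rfl⟩ := h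
  refine ⟨homogeneousComponent n c, homogeneousComponent_isHomogeneous _ _, ?_⟩
  have h1 : homogeneousComponent (m + n) (q * c) = q * homogeneousComponent n c := by
    conv_lhs => rw [← sum_homogeneousComponent c, Finset.mul_sum, map_sum]
    have h2 : ∀ i, homogeneousComponent (m + n) (q * homogeneousComponent i c) =
        if i = n then q * homogeneousComponent n c else 0 := by
      intro i
      rw [homogeneousComponent_of_mem (hq.mul (homogeneousComponent_isHomogeneous i c))]
      by_cases hi : i = n
      · simp [hi]
      · rw [if_neg (by omega), if_neg hi]
    simp only [h2, Finset.sum_ite_eq', Finset.mem_range]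
    split_ifs with hn
    · rfl
    · rw [homogeneousComponent_eq_zero _ _ (by omega), mul_zero]
  rw [← h1, homogeneousComponent_eq_self hp]

theorem finrank_restrictSupport {σ : Type*} (s : Set (σ →₀ ℕ)) :
    Module.finrank ℝ (restrictSupport ℝ s) = Nat.card s := by
  rw [Module.finrank_eq_nat_card_basis (basisRestrictSupport ℝ s)]

theorem card_degree_eq (d n : ℕ) :
    Nat.card {f : Fin (d + 1) →₀ ℕ | f.degree = n} = (n + d).choose d := by
  have h : {f : Fin (d + 1) →₀ ℕ | f.degree = n} =
      (Finset.univ.finsuppAntidiag n : Finset (Fin (d + 1) →₀ ℕ)) := by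
    ext f
    simp [Finsupp.degree_eq_sum]
  rw [h, Nat.card_coe_set_eq, Set.ncard_coe_finset, Finset.card_finsuppAntidiag_nat_eq_choose,
    Finset.card_univ, Fintype.card_fin, ← Nat.choose_symm (Nat.le_add_left d n)]
  congr 1 <;> omega

theorem sum_exponent_eq {d : ℕ} (f : Fin d →₀ ℕ) : (f.sum fun _ e => e) = ∑ i, f i :=
  f.sum_fintype _ fun _ => rfl

/-- Adding a variable that makes up for the missing degree. -/
def homogenizeExponent (d n : ℕ) :
    {f : Fin d →₀ ℕ | (f.sum fun _ e => e) ≤ n} ≃ {f : Fin (d + 1) →₀ ℕ | f.degree = n} where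
  toFun f := ⟨Finsupp.cons (n - ∑ i, f.1 i) f.1, by
    have h := f.2
    simp only [Set.mem_ofPred_eq, Finsupp.degree_eq_sum, Fin.sum_univ_succ, Finsupp.cons_zero,
      Finsupp.cons_succ, sum_exponent_eq] at h ⊢
    omega⟩
  invFun f := ⟨Finsupp.tail f.1, by
    have h := f.2
    simp only [Set.mem_ofPred_eq, Finsupp.degree_eq_sum, Fin.sum_univ_succ, Finsupp.tail_apply,
      sum_exponent_eq] at h ⊢
    omega⟩
  left_inv f := by simp
  right_inv f := by
    have h := f.2
    ext i
    simp only [Set.mem_ofPred_eq, Finsupp.degree_eq_sum, Fin.sum_univ_succ] at h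
    refine Fin.cases ?_ (fun j => ?_) i
    · simp only [Finsupp.cons_zero, Finsupp.tail_apply]
      omega
    · simp only [Finsupp.cons_succ, Finsupp.tail_apply]

theorem finrank_homogeneousSubmodule (d n : ℕ) :
    Module.finrank ℝ (homogeneousSubmodule (Fin (d + 1)) ℝ n) = (n + d).choose d := by
  rw [homogeneousSubmodule_eq_finsupp_supported, ← card_degree_eq]
  exact finrank_restrictSupport _

theorem finrank_restrictTotalDegree (d n : ℕ) :
    Module.finrank ℝ (restrictTotalDegree (Fin d) ℝ n) = (n + d).choose d := by
  rw [← card_degree_eq, ← Nat.card_congr (homogenizeExponent d n)]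
  exact finrank_restrictSupport _

theorem denominator_ne_zero (S : Finset (EuclideanSpace ℝ (Fin d))) : denominator S ≠ 0 := by
  refine Finset.prod_ne_zero_iff.2 fun v _ h => ?_
  simpa using congrArg (eval (0 : Fin d → ℝ)) h

/-- Division by the nonzero denominator is injective, so only the numerators need counting. -/
theorem finrank_rationalSpace (S : Finset (EuclideanSpace ℝ (Fin d))) :
    Module.finrank ℝ (rationalSpace S) = (S.card - (d + 1) + d).choose d := by
  rw [← finrank_restrictTotalDegree]
  refine (LinearEquiv.finrank_eq (Submodule.equivMapOfInjective _ ?_ _)).symm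
  refine Function.Injective.comp (g := fun x => x * _) (mul_left_injective₀ ?_)
    (IsFractionRing.injective (MvPolynomial (Fin d) ℝ) (FractionRing (MvPolynomial (Fin d) ℝ)))
  exact inv_ne_zero ((map_ne_zero_iff _ (IsFractionRing.injective _ _)).2 (denominator_ne_zero S))

end Polynomials

/-! ### Independence of products of linear forms -/

/-- An affine function of the point that vanishes on an affine basis vanishes everywhere. Its values
at 0 and at the unit vectors recover `a`. -/
theorem IsSimplexVertexSet.eq_zero_of_pairing {V : Finset (EuclideanSpace ℝ (Fin d))}
    (hV : IsSimplexVertexSet V) {a : Fin (d + 1) → ℝ} (h : ∀ v ∈ V, pairing a v = 0) : a = 0 := by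
  have h0 : ∀ x, pairing a x = 0 := by
    intro x
    have h1 := conePairing_sum Finset.univ a (fun v : V => hV.basis.coord v x) fun v => v
    rw [hV.basis.sum_coord_apply_eq_one x] at h1
    have h2 := hV.basis.linear_combination_coord_eq_self x
    simp only [hV.basis_apply] at h2
    rw [h2] at h1
    rw [← one_mul (pairing a x), ← conePairing_smul, one_smul, h1]
    exact Finset.sum_eq_zero fun v _ => by rw [h v v.2, mul_zero]
  have ha0 : a 0 = 0 := by simpa [pairing] using h0 0
  funext i
  refine Fin.cases ha0 (fun k => ?_) i
  have h1 := h0 (EuclideanSpace.single k 1)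
  simpa [pairing, ha0, Pi.single_apply] using h1

/-- These are d linear conditions on d + 1 unknowns. -/
theorem exists_pairing_eq_zero (U : Finset (EuclideanSpace ℝ (Fin d))) (hU : U.card = d) :
    ∃ a : Fin (d + 1) → ℝ, a ≠ 0 ∧ ∀ u ∈ U, pairing a u = 0 := by
  let φ : (Fin (d + 1) → ℝ) →ₗ[ℝ] (U → ℝ) :=
    { toFun := fun a u => pairing a u
      map_add' := fun a b => by
        funext u
        simp only [pairing, Pi.add_apply, mul_add, Finset.sum_add_distrib]
        ring
      map_smul' := fun c a => by
        funext u
        simp only [pairing, Pi.smul_apply, smul_eq_mul, RingHom.id_apply, mul_sub,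
          Finset.mul_sum, mul_left_comm] }
  obtain ⟨a, ha, ha0⟩ := (Submodule.ne_bot_iff _).1 (LinearMap.ker_ne_bot_of_finrank_lt (f := φ)
    (by simp [hU]))
  exact ⟨a, ha0, fun u hu => congrFun (LinearMap.mem_ker.1 ha) ⟨u, hu⟩⟩

/-- The polynomials `∏_{v ∈ S \ V} ℓ_v`, for the `(d+1)`-element subsets `V` of `S` containing a
fixed point, are linearly independent. -/
theorem linearIndependent_linFormProd {S : Finset (EuclideanSpace ℝ (Fin d))} (hS : StronglyNonDegenerate S)
    (o : EuclideanSpace ℝ (Fin d)) :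
    LinearIndependent ℝ fun U : (S.erase o).powersetCard d => linFormProd (S \ insert o U.1) := by
  rw [linearIndependent_iff']
  intro I g hg U hUI
  obtain ⟨hUS, hUc⟩ := Finset.mem_powersetCard.1 U.2
  -- Evaluation at `a` isolates the coefficient of `U`. The forms of points of `S` outside `U` do
  -- not vanish at `a`, by non-degeneracy, while the product for any other `W` contains the form of
  -- some point of `U \ W`.
  obtain ⟨a, ha0, ha⟩ := exists_pairing_eq_zero U.1 hUc
  have hne : ∀ w ∈ S, w ∉ U.1 → pairing a w ≠ 0 := by
    intro w hw hwU h
    have hc : (insert w U.1).card = d + 1 := by rw [Finset.card_insert_of_notMem hwU, hUc]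
    refine ha0 (IsSimplexVertexSet.eq_zero_of_pairing (V := insert w U.1) ⟨hc, hS.2 _ ?_ hc⟩ ?_)
    · exact Finset.insert_subset hw (hUS.trans (Finset.erase_subset _ _))
    · intro v hv
      rcases Finset.mem_insert.1 hv with rfl | hv
      exacts [h, ha v hv]
  have he := congrArg (MvPolynomial.eval a) hg
  simp only [map_sum, MvPolynomial.smul_eval, eval_linFormProd, map_zero] at he
  rw [Finset.sum_eq_single_of_mem U hUI] at he
  · refine (mul_eq_zero.1 he).resolve_right (Finset.prod_ne_zero_iff.2 fun v hv => ?_)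
    rw [Finset.mem_sdiff, Finset.mem_insert, not_or] at hv
    exact hne v hv.1 hv.2.2
  · intro W _ hWU
    obtain ⟨-, hWc⟩ := Finset.mem_powersetCard.1 W.2
    obtain ⟨u, hu, huW⟩ : ∃ u ∈ U.1, u ∉ W.1 := by
      by_contra! hsub
      exact hWU (Subtype.ext (Finset.eq_of_subset_of_card_le hsub (by omega)).symm)
    rw [Finset.prod_eq_zero (i := u) _ (ha u hu), mul_zero]
    have := Finset.mem_erase.1 (hUS hu)
    simp [this.1, this.2, huW]

/-! ### Formal combinations of simplices and their numerators -/

/-- The interior of the convex hull of `V`. -/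
def openHull (V : Finset (EuclideanSpace ℝ (Fin d))) : Set (EuclideanSpace ℝ (Fin d)) :=
  interior (convexHull ℝ (V : Set (EuclideanSpace ℝ (Fin d))))

theorem isCompact_convexHull (V : Finset (EuclideanSpace ℝ (Fin d))) :
    IsCompact (convexHull ℝ (V : Set (EuclideanSpace ℝ (Fin d)))) :=
  V.finite_toSet.isCompact_convexHull ℝ

theorem measurableSet_openHull (V : Finset (EuclideanSpace ℝ (Fin d))) :
    MeasurableSet (openHull V) := isOpen_interior.measurableSet

theorem openHull_ae_eq (V : Finset (EuclideanSpace ℝ (Fin d))) :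
    openHull V =ᵐ[volume] convexHull ℝ (V : Set (EuclideanSpace ℝ (Fin d))) :=
  interior_ae_eq_of_null_frontier ((convex_convexHull ℝ _).addHaar_frontier volume)

theorem IsSimplexVertexSet.closure_openHull {V : Finset (EuclideanSpace ℝ (Fin d))}
    (hV : IsSimplexVertexSet V) :
    closure (openHull V) = convexHull ℝ (V : Set (EuclideanSpace ℝ (Fin d))) := by
  rw [openHull, (convex_convexHull ℝ _).closure_interior_eq_closure_of_nonempty_interior
    (interior_convexHull_nonempty_iff_affineSpan_eq_top.2 hV.2),
    (isCompact_convexHull V).isClosed.closure_eq]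

/-- The function `∑ c_V χ_V` attached to a formal combination of simplices. -/
def simplexFun : (Finset (EuclideanSpace ℝ (Fin d)) →₀ ℝ) →ₗ[ℝ] EuclideanSpace ℝ (Fin d) → ℝ :=
  Finsupp.linearCombination ℝ fun V => (openHull V).indicator fun _ => (1 : ℝ)

/-- The measure `∑ c_V μ_V` attached to a formal combination of simplices. -/
def simplexMeasure : (Finset (EuclideanSpace ℝ (Fin d)) →₀ ℝ) →ₗ[ℝ]
    SignedMeasure (EuclideanSpace ℝ (Fin d)) :=
  Finsupp.linearCombination ℝ fun V =>
    standardMeasure (convexHull ℝ (V : Set (EuclideanSpace ℝ (Fin d))))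

/-- The numerator, over the common denominator `∏_{v ∈ A} ℓ_v`, of the Cauchy transform of a formal
combination of simplices with vertices in `A`. -/
def numerator (A : Finset (EuclideanSpace ℝ (Fin d))) :
    (Finset (EuclideanSpace ℝ (Fin d)) →₀ ℝ) →ₗ[ℝ] MvPolynomial (Fin (d + 1)) ℝ :=
  Finsupp.linearCombination ℝ fun V => volume.real (openHull V) • linFormProd (A \ V)

/-- The formal combinations of simplices with vertices in `A`. -/
def simplexChains (A : Finset (EuclideanSpace ℝ (Fin d))) :
    Submodule ℝ (Finset (EuclideanSpace ℝ (Fin d)) →₀ ℝ) :=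
  Finsupp.supported ℝ ℝ {V | IsSimplexVertexSet V ∧ V ⊆ A}

theorem simplexChains_mono {A B : Finset (EuclideanSpace ℝ (Fin d))} (h : A ⊆ B) :
    simplexChains A ≤ simplexChains B :=
  Finsupp.supported_mono fun _ hV => ⟨hV.1, hV.2.trans h⟩

theorem mem_simplexChains {A : Finset (EuclideanSpace ℝ (Fin d))}
    {c : Finset (EuclideanSpace ℝ (Fin d)) →₀ ℝ} :
    c ∈ simplexChains A ↔ ∀ V ∈ c.support, IsSimplexVertexSet V ∧ V ⊆ A :=
  Finsupp.mem_supported ℝ c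

theorem simplexFun_apply (c : Finset (EuclideanSpace ℝ (Fin d)) →₀ ℝ)
    (x : EuclideanSpace ℝ (Fin d)) :
    simplexFun c x = ∑ V ∈ c.support, c V * (openHull V).indicator (fun _ => (1 : ℝ)) x := by
  simp [simplexFun, Finsupp.linearCombination_apply, Finsupp.sum, Finset.sum_apply]

theorem measurable_simplexFun (c : Finset (EuclideanSpace ℝ (Fin d)) →₀ ℝ) :
    Measurable (simplexFun c) := by
  simp only [funext (simplexFun_apply c)]
  exact Finset.measurable_sum _ fun V _ =>
    measurable_const.mul (measurable_const.indicator (measurableSet_openHull V))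

theorem simplexFun_mul_eq (c : Finset (EuclideanSpace ℝ (Fin d)) →₀ ℝ)
    (g : EuclideanSpace ℝ (Fin d) → ℝ) (x : EuclideanSpace ℝ (Fin d)) :
    simplexFun c x * g x = ∑ V ∈ c.support, c V * (openHull V).indicator g x := by
  rw [simplexFun_apply, Finset.sum_mul]
  refine Finset.sum_congr rfl fun V _ => ?_
  by_cases hx : x ∈ openHull V <;> simp [hx]

theorem integrable_indicator_openHull {V : Finset (EuclideanSpace ℝ (Fin d))}
    {g : EuclideanSpace ℝ (Fin d) → ℝ}
    (hg : ContinuousOn g (convexHull ℝ (V : Set (EuclideanSpace ℝ (Fin d))))) :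
    Integrable ((openHull V).indicator g) :=
  (integrable_indicator_iff (measurableSet_openHull V)).2
    ((hg.integrableOn_compact (isCompact_convexHull V)).mono_set interior_subset)

theorem integrable_simplexFun_mul {c : Finset (EuclideanSpace ℝ (Fin d)) →₀ ℝ}
    {g : EuclideanSpace ℝ (Fin d) → ℝ} (hg : ∀ V ∈ c.support,
      ContinuousOn g (convexHull ℝ (V : Set (EuclideanSpace ℝ (Fin d))))) :
    Integrable fun x => simplexFun c x * g x := by
  simp only [simplexFun_mul_eq]
  exact integrable_finsetSum _ fun V hV => (integrable_indicator_openHull (hg V hV)).const_mul _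

theorem integral_simplexFun_mul {c : Finset (EuclideanSpace ℝ (Fin d)) →₀ ℝ}
    {g : EuclideanSpace ℝ (Fin d) → ℝ} (hg : ∀ V ∈ c.support,
      ContinuousOn g (convexHull ℝ (V : Set (EuclideanSpace ℝ (Fin d))))) :
    ∫ x, simplexFun c x * g x = ∑ V ∈ c.support, c V * ∫ x in openHull V, g x := by
  simp only [simplexFun_mul_eq]
  rw [integral_finsetSum _ fun V hV => (integrable_indicator_openHull (hg V hV)).const_mul _]
  refine Finset.sum_congr rfl fun V _ => ?_
  rw [integral_const_mul, integral_indicator (measurableSet_openHull V)]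

theorem integrable_simplexFun (c : Finset (EuclideanSpace ℝ (Fin d)) →₀ ℝ) :
    Integrable (simplexFun c) := by
  simpa using integrable_simplexFun_mul (c := c) (g := fun _ => 1) fun V _ => continuousOn_const

theorem exists_norm_le (A : Finset (EuclideanSpace ℝ (Fin d))) :
    ∃ R : ℝ, 0 ≤ R ∧ ∀ v ∈ A, ‖v‖ ≤ R := by
  obtain ⟨R, hR⟩ := A.finite_toSet.isBounded.exists_norm_le
  exact ⟨max R 0, le_max_right _ _, fun v hv => (hR v hv).trans (le_max_left _ _)⟩

theorem simplexFun_eq_zero_of_norm_lt {A : Finset (EuclideanSpace ℝ (Fin d))}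
    {c : Finset (EuclideanSpace ℝ (Fin d)) →₀ ℝ} (hc : c ∈ simplexChains A) {R : ℝ}
    (hR : ∀ v ∈ A, ‖v‖ ≤ R) (x : EuclideanSpace ℝ (Fin d)) (hx : R < ‖x‖) :
    simplexFun c x = 0 := by
  rw [simplexFun_apply]
  refine Finset.sum_eq_zero fun V hV => ?_
  rw [Set.indicator_of_notMem, mul_zero]
  intro h
  have hsub : convexHull ℝ (V : Set (EuclideanSpace ℝ (Fin d))) ⊆ Metric.closedBall 0 R :=
    convexHull_min (fun v hv => by simpa using hR v ((mem_simplexChains.1 hc V hV).2 hv))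
      (convex_closedBall _ _)
  have := hsub (interior_subset h)
  rw [mem_closedBall_zero_iff] at this
  exact absurd this (not_le.2 hx)

/-- The simplex integral is applied termwise; clearing the common denominator leaves the forms of `A
\ V` in the term of `V`. -/
theorem cauchyTransform_simplexFun_mul_prod {A : Finset (EuclideanSpace ℝ (Fin d))}
    {c : Finset (EuclideanSpace ℝ (Fin d)) →₀ ℝ} (hc : c ∈ simplexChains A)
    {a : Fin (d + 1) → ℝ} (ha : ∀ v ∈ A, 0 < pairing a v) :
    cauchyTransform (simplexFun c) a * ∏ v ∈ A, pairing a v =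
      MvPolynomial.eval a (numerator A c) := by
  rw [mem_simplexChains] at hc
  rw [cauchyTransform, integral_simplexFun_mul, Finset.sum_mul, numerator,
    Finsupp.linearCombination_apply, Finsupp.sum, map_sum]
  · refine Finset.sum_congr rfl fun V hV => ?_
    obtain ⟨hV, hVA⟩ := hc V hV
    rw [MvPolynomial.smul_eval, MvPolynomial.smul_eval, eval_linFormProd, openHull,
      ← hV.integral_mul_prod fun v hv => ha v (hVA hv), ← Finset.prod_sdiff hVA]
    ring
  · intro V hV
    refine ((continuous_pairing a).pow _).continuousOn.inv₀ fun x hx => ?_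
    exact (pow_pos (pairing_pos_of_mem_convexHull (fun v hv => ha v ((hc V hV).2 hv)) hx) _).ne'

theorem eq_zero_of_eval_eq_zero {p : MvPolynomial (Fin (d + 1)) ℝ} (R : ℝ)
    (h : ∀ a : Fin (d + 1) → ℝ, (∀ x, ‖x‖ ≤ R → 0 < pairing a x) → MvPolynomial.eval a p = 0) :
    p = 0 := by
  -- The positivity region contains the box (dR, ∞) × [-1, 1]^d, a product of infinite sets, since
  -- |x_k| ≤ ‖x‖ ≤ R.
  refine MvPolynomial.funext_set
    (Fin.cons (Set.Ioi (d * R)) fun _ => Set.Icc (-1) 1 : Fin (d + 1) → Set ℝ) (fun i => ?_)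
    fun a ha => ?_
  · refine Fin.cases ?_ (fun k => ?_) i
    · exact Set.Ioi_infinite _
    · exact Set.Icc_infinite (by norm_num)
  · rw [map_zero]
    refine h a fun x hx => ?_
    have h0 : d * R < a 0 := ha 0 (Set.mem_univ _)
    have hk : ∀ k : Fin d, |a k.succ| ≤ 1 := fun k => abs_le.2 (ha k.succ (Set.mem_univ _))
    rw [pairing, sub_pos]
    refine lt_of_le_of_lt ?_ h0
    calc ∑ k, x k * a k.succ ≤ ∑ _k : Fin d, R := by
          refine Finset.sum_le_sum fun k _ => (le_abs_self _).trans ?_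
          rw [abs_mul]
          calc |x k| * |a k.succ| ≤ |x k| * 1 := by gcongr; exact hk k
            _ ≤ R := by
              rw [mul_one]
              exact (PiLp.norm_apply_le x k).trans hx
      _ = d * R := by simp

theorem numerator_eq_zero_iff {A : Finset (EuclideanSpace ℝ (Fin d))}
    {c : Finset (EuclideanSpace ℝ (Fin d)) →₀ ℝ} (hc : c ∈ simplexChains A) :
    numerator A c = 0 ↔ simplexFun c =ᵐ[volume] 0 := by
  obtain ⟨R, hR0, hR⟩ := exists_norm_le A
  constructor
  · intro h
    refine ae_eq_zero_of_cauchyTransform (measurable_simplexFun c) (integrable_simplexFun c) hR0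
      (simplexFun_eq_zero_of_norm_lt hc hR) fun a ha => ?_
    have ha' : ∀ v ∈ A, 0 < pairing a v := fun v hv => ha v (hR v hv)
    have h1 := cauchyTransform_simplexFun_mul_prod hc ha'
    rw [h, map_zero] at h1
    exact (mul_eq_zero.1 h1).resolve_right (Finset.prod_pos ha').ne'
  · intro h
    refine eq_zero_of_eval_eq_zero R fun a ha => ?_
    rw [← cauchyTransform_simplexFun_mul_prod hc fun v hv => ha v (hR v hv)]
    have h1 : cauchyTransform (simplexFun c) a = 0 := by
      refine integral_eq_zero_of_ae ?_
      filter_upwards [h] with x hx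
      simp [hx]
    rw [h1, zero_mul]

theorem standardMeasure_convexHull (V : Finset (EuclideanSpace ℝ (Fin d))) :
    standardMeasure (convexHull ℝ (V : Set (EuclideanSpace ℝ (Fin d)))) =
      (volume : Measure (EuclideanSpace ℝ (Fin d))).withDensityᵥ
        ((openHull V).indicator fun _ => (1 : ℝ)) :=
  WithDensityᵥEq.congr_ae (indicator_ae_eq_of_ae_eq_set (openHull_ae_eq V).symm)

theorem simplexMeasure_eq (c : Finset (EuclideanSpace ℝ (Fin d)) →₀ ℝ) :
    simplexMeasure c =
      (volume : Measure (EuclideanSpace ℝ (Fin d))).withDensityᵥ (simplexFun c) := by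
  induction c using Finsupp.induction_linear with
  | zero => rw [map_zero, map_zero, withDensityᵥ_zero]
  | add f g hf hg =>
    rw [map_add, map_add, withDensityᵥ_add (integrable_simplexFun f) (integrable_simplexFun g),
      hf, hg]
  | single V b =>
    rw [simplexMeasure, simplexFun, Finsupp.linearCombination_single,
      Finsupp.linearCombination_single, withDensityᵥ_smul, standardMeasure_convexHull]

theorem simplexMeasure_eq_zero_iff (c : Finset (EuclideanSpace ℝ (Fin d)) →₀ ℝ) :
    simplexMeasure c = 0 ↔ simplexFun c =ᵐ[volume] 0 := by
  rw [simplexMeasure_eq, ← withDensityᵥ_zero (μ := volume)]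
  exact (integrable_simplexFun c).withDensityᵥ_eq_iff (integrable_zero _ _ _)

/-- The dictionary between linear relations among simplex measures and polynomial identities. -/
theorem numerator_eq_zero_iff_simplexMeasure {A : Finset (EuclideanSpace ℝ (Fin d))}
    {c : Finset (EuclideanSpace ℝ (Fin d)) →₀ ℝ} (hc : c ∈ simplexChains A) :
    numerator A c = 0 ↔ simplexMeasure c = 0 := by
  rw [numerator_eq_zero_iff hc, simplexMeasure_eq_zero_iff]

theorem isHomogeneous_numerator {A : Finset (EuclideanSpace ℝ (Fin d))}
    {c : Finset (EuclideanSpace ℝ (Fin d)) →₀ ℝ} (hc : c ∈ simplexChains A) :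
    (numerator A c).IsHomogeneous (A.card - (d + 1)) := by
  rw [← MvPolynomial.mem_homogeneousSubmodule, numerator, Finsupp.linearCombination_apply]
  refine Submodule.sum_mem _ fun V hV => Submodule.smul_mem _ _ (Submodule.smul_mem _ _ ?_)
  obtain ⟨hV, hVA⟩ := mem_simplexChains.1 hc V hV
  have h := isHomogeneous_linFormProd (A \ V)
  rwa [Finset.card_sdiff_of_subset hVA, hV.1] at h

/-- Allowing more vertices expands the fraction by the additional linear forms. -/
theorem numerator_of_subset {A B : Finset (EuclideanSpace ℝ (Fin d))} (hAB : A ⊆ B)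
    {c : Finset (EuclideanSpace ℝ (Fin d)) →₀ ℝ} (hc : c ∈ simplexChains A) :
    numerator B c = linFormProd (B \ A) * numerator A c := by
  rw [numerator, numerator, Finsupp.linearCombination_apply, Finsupp.linearCombination_apply,
    Finsupp.sum, Finsupp.sum, Finset.mul_sum]
  refine Finset.sum_congr rfl fun V hV => ?_
  obtain ⟨-, hVA⟩ := mem_simplexChains.1 hc V hV
  rw [mul_smul_comm, mul_smul_comm, linFormProd, linFormProd, linFormProd,
    ← Finset.prod_union (Finset.disjoint_left.2 fun v h1 h2 =>
      (Finset.mem_sdiff.1 h1).2 (Finset.mem_sdiff.1 h2).1)]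
  congr 3
  ext v
  simp only [Finset.mem_union, Finset.mem_sdiff]
  have := @hAB v
  have := @hVA v
  tauto

/-! ### Every form of the right degree is a numerator -/

/-- Ensures that the natural-number subtraction `S.card - (d + 1)` is never truncated. -/
theorem IsSpanning.card_ge {S : Finset (EuclideanSpace ℝ (Fin d))} (hS : IsSpanning S) :
    d + 1 ≤ S.card := by
  obtain ⟨n, hn⟩ : ∃ n, S.card = n + 1 := by
    refine Nat.exists_eq_succ_of_ne_zero fun h => ?_
    rw [Finset.card_eq_zero] at h
    subst h
    rw [IsSpanning, Finset.coe_empty, AffineSubspace.span_empty] at hS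
    exact AffineSubspace.bot_ne_top ℝ _ _ hS
  have h := finrank_vectorSpan_range_le ℝ (Subtype.val : S → EuclideanSpace ℝ (Fin d)) (n := n)
    (by simpa using hn)
  rw [← direction_affineSpan, Subtype.range_coe_subtype] at h
  have h' : affineSpan ℝ {x | x ∈ S} = ⊤ := hS
  rw [h', AffineSubspace.direction_top, finrank_top, finrank_euclideanSpace_fin] at h
  omega

/-- The numerators of combinations of simplices with vertices in a strongly non-degenerate set are
all forms of degree `|S| - d - 1`. -/
theorem StronglyNonDegenerate.map_numerator {S : Finset (EuclideanSpace ℝ (Fin d))}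
    (hS : StronglyNonDegenerate S) :
    (simplexChains S).map (numerator S) =
      MvPolynomial.homogeneousSubmodule (Fin (d + 1)) ℝ (S.card - (d + 1)) := by
  have hcard := hS.1.card_ge
  obtain ⟨o, ho⟩ : S.Nonempty := Finset.card_pos.1 (by omega)
  have hle : (simplexChains S).map (numerator S) ≤
      MvPolynomial.homogeneousSubmodule (Fin (d + 1)) ℝ (S.card - (d + 1)) := by
    rintro _ ⟨c, hc, rfl⟩
    exact isHomogeneous_numerator hc
  have hfin : Module.Finite ℝ
      (MvPolynomial.homogeneousSubmodule (Fin (d + 1)) ℝ (S.card - (d + 1))) :=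
    Module.Finite.iff_fg.2 (MvPolynomial.homogeneousSubmodule_fg _ _ _)
  refine Submodule.eq_of_le_of_finrank_le hle ?_
  have hspan : Submodule.span ℝ (Set.range fun U : (S.erase o).powersetCard d =>
      linFormProd (S \ insert o U.1)) ≤ (simplexChains S).map (numerator S) := by
    rw [Submodule.span_le]
    rintro _ ⟨U, rfl⟩
    obtain ⟨hUS, hUc⟩ := Finset.mem_powersetCard.1 U.2
    have hoU : o ∉ U.1 := fun h => (Finset.mem_erase.1 (hUS h)).1 rfl
    have hc : (insert o U.1).card = d + 1 := by rw [Finset.card_insert_of_notMem hoU, hUc]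
    have hsub : insert o U.1 ⊆ S :=
      Finset.insert_subset ho (hUS.trans (Finset.erase_subset _ _))
    have hV : IsSimplexVertexSet (insert o U.1) := ⟨hc, hS.2 _ hsub hc⟩
    -- The inverse volume cancels the factor built into the numerator of a single simplex.
    refine ⟨Finsupp.single (insert o U.1) (volume.real (openHull (insert o U.1)))⁻¹,
      Finsupp.single_mem_supported ℝ _ ⟨hV, hsub⟩, ?_⟩
    rw [numerator, Finsupp.linearCombination_single]
    exact inv_smul_smul₀ hV.volume_pos.ne' _
  have hfin' := Submodule.finiteDimensional_of_le hle
  -- The independent products already number binom(N-1, d), the dimension of the whole space of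
  -- forms.
  refine le_trans ?_ (Submodule.finrank_mono hspan)
  rw [finrank_span_eq_card (linearIndependent_linFormProd hS o), Fintype.card_coe,
    Finset.card_powersetCard, Finset.card_erase_of_mem ho, finrank_homogeneousSubmodule]
  refine le_of_eq ?_
  congr 1
  omega

/-! ### Dissections and the reduction to simplices with vertices in S -/

theorem exists_dissection_of_notMem {S : Finset (EuclideanSpace ℝ (Fin d))}
    {P : Set (EuclideanSpace ℝ (Fin d))} (hP : vertices P ⊆ S) {v : EuclideanSpace ℝ (Fin d)}
    (hv : v ∉ S) : ∃ T, IsDissection P T ∧ ∀ V ∈ T, v ∉ V := by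
  have h : v ∉ vertices P := fun h => hv (hP h)
  simpa [vertices] using h

/-- No triangulation theorem is needed: for positive dimension some point lies outside the finite
set `S`, and its not being a vertex already provides a dissection. Dimension 0 is done by hand,
because there `S` may be the whole space. -/
theorem exists_dissection {S : Finset (EuclideanSpace ℝ (Fin d))}
    {P : Set (EuclideanSpace ℝ (Fin d))} (hP : vertices P ⊆ S) : ∃ T, IsDissection P T := by
  rcases d with _ | d
  · rcases Set.eq_empty_or_nonempty P with rfl | ⟨x, hx⟩
    · exact ⟨∅, by simp, by simp, by simp⟩
    · have hspan : IsSpanning ({x} : Finset (EuclideanSpace ℝ (Fin 0))) := by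
        rw [IsSpanning, eq_top_iff]
        intro y _
        rw [Subsingleton.elim y x]
        exact mem_affineSpan ℝ (by simp)
      refine ⟨{{x}}, ?_, ?_, ?_⟩
      · simpa [IsSimplexVertexSet] using hspan
      · simp
      · have h : ∀ s : Set (EuclideanSpace ℝ (Fin 0)), x ∈ s → s = Set.univ := fun s hs =>
          Set.eq_univ_of_forall fun y => Subsingleton.elim x y ▸ hs
        simp [h P hx, h {x} rfl]
  · obtain ⟨v, hv⟩ := Infinite.exists_notMem_finset S
    obtain ⟨T, hT, -⟩ := exists_dissection_of_notMem hP hv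
    exact ⟨T, hT⟩

/-- The sum of the simplices of a dissection. -/
def dissectionChain (T : Finset (Finset (EuclideanSpace ℝ (Fin d)))) :
    Finset (EuclideanSpace ℝ (Fin d)) →₀ ℝ :=
  ∑ V ∈ T, Finsupp.single V 1

/-- Disjointness makes the indicators of the open simplices add up to that of their union, which
differs from `P` only within the null boundaries of the simplices. -/
theorem IsDissection.simplexMeasure_eq {P : Set (EuclideanSpace ℝ (Fin d))}
    {T : Finset (Finset (EuclideanSpace ℝ (Fin d)))} (hT : IsDissection P T) :
    simplexMeasure (dissectionChain T) = standardMeasure P := by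
  rw [PolytopalMeasure.simplexMeasure_eq]
  have hP : (⋃ V ∈ T, openHull V) =ᵐ[volume] P := by
    have h1 : P = ⋃ V ∈ T, convexHull ℝ (V : Set (EuclideanSpace ℝ (Fin d))) := by
      rw [← hT.closure_eq, T.closure_biUnion]
      exact Set.iUnion₂_congr fun V hV => (hT.simplex V hV).closure_openHull
    rw [h1]
    exact Filter.EventuallyEq.countable_bUnion T.countable_toSet fun V _ => openHull_ae_eq V
  have hfun : simplexFun (dissectionChain T) =
      (⋃ V ∈ T, openHull V).indicator fun _ => (1 : ℝ) := by
    rw [Finset.indicator_biUnion T openHull fun V hV W hW hVW => hT.disjoint V hV W hW hVW,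
      dissectionChain, map_sum]
    funext x
    simp [simplexFun, Finset.sum_apply]
  rw [hfun]
  exact WithDensityᵥEq.congr_ae (indicator_ae_eq_of_ae_eq_set hP)

theorem IsDissection.chain_mem {P : Set (EuclideanSpace ℝ (Fin d))}
    {T : Finset (Finset (EuclideanSpace ℝ (Fin d)))} (hT : IsDissection P T)
    {A : Finset (EuclideanSpace ℝ (Fin d))} (hA : ∀ V ∈ T, V ⊆ A) :
    dissectionChain T ∈ simplexChains A :=
  Submodule.sum_mem _ fun V hV =>
    Finsupp.single_mem_supported ℝ _ ⟨hT.simplex V hV, hA V hV⟩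

/-- If a measure is represented by two chains, one of which does not use the vertex `v`, then the
linear form of `v` divides the numerator of the other. -/
theorem linForm_dvd_numerator {A B : Finset (EuclideanSpace ℝ (Fin d))}
    {c c' : Finset (EuclideanSpace ℝ (Fin d)) →₀ ℝ} (hc : c ∈ simplexChains A)
    (hc' : c' ∈ simplexChains B) (h : simplexMeasure c = simplexMeasure c')
    {v : EuclideanSpace ℝ (Fin d)} (hvA : v ∈ A) (hvB : v ∉ B) : linForm v ∣ numerator A c := by
  have hu := simplexChains_mono (Finset.subset_union_left (s₂ := B)) hc
  have hu' := simplexChains_mono (Finset.subset_union_right (s₁ := A)) hc'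
  -- Over the common vertex set `A ∪ B` the two numerators agree. The one of `c'` carries the factor
  -- ℓ_v because `v` is not in `B`, while the factor added to `numerator A c` involves only points
  -- outside `A`.
  have h0 : numerator (A ∪ B) (c - c') = 0 := by
    rw [numerator_eq_zero_iff_simplexMeasure (Submodule.sub_mem _ hu hu'), map_sub, h, sub_self]
  rw [map_sub, sub_eq_zero, numerator_of_subset Finset.subset_union_left hc,
    numerator_of_subset Finset.subset_union_right hc'] at h0
  have hd : linForm v ∣ linFormProd ((A ∪ B) \ A) * numerator A c := by
    rw [h0]
    exact (Finset.dvd_prod_of_mem linForm (by simp [hvA, hvB])).mul_right _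
  exact ((prime_linForm v).dvd_or_dvd hd).resolve_left
    (linForm_not_dvd_linFormProd (by simp [hvA]))

theorem StronglyNonDegenerate.standardMeasure_mem {S : Finset (EuclideanSpace ℝ (Fin d))}
    (hS : StronglyNonDegenerate S) {P : Set (EuclideanSpace ℝ (Fin d))} (hP : vertices P ⊆ S) :
    standardMeasure P ∈ (simplexChains S).map simplexMeasure := by
  obtain ⟨T, hT⟩ := exists_dissection hP
  let A := S ∪ T.biUnion id
  have hSA : S ⊆ A := Finset.subset_union_left
  have hTA : ∀ V ∈ T, V ⊆ A := fun V hV =>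
    (Finset.subset_biUnion_of_mem id hV).trans Finset.subset_union_right
  have hc := hT.chain_mem hTA
  have hdvd : linFormProd (A \ S) ∣ numerator A (dissectionChain T) := by
    refine linFormProd_dvd fun v hv => ?_
    obtain ⟨hvA, hvS⟩ := Finset.mem_sdiff.1 hv
    -- Since `v` is not a vertex of `P`, this second dissection avoids it, which makes ℓ_v a
    -- removable factor of the denominator.
    obtain ⟨T', hT', hv'⟩ := exists_dissection_of_notMem hP hvS
    refine linForm_dvd_numerator hc (hT'.chain_mem (A := T'.biUnion id) fun V hV =>
      Finset.subset_biUnion_of_mem id hV) ?_ hvA (by simpa using hv')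
    rw [hT.simplexMeasure_eq, hT'.simplexMeasure_eq]
  have hcard := hS.1.card_ge
  have hhom := isHomogeneous_numerator hc
  have hdeg : A.card - (d + 1) = (A \ S).card + (S.card - (d + 1)) := by
    have := Finset.card_sdiff_add_card_eq_card hSA
    omega
  rw [hdeg] at hhom
  obtain ⟨r, hr, hr'⟩ := exists_isHomogeneous_of_dvd (isHomogeneous_linFormProd _) hhom hdvd
  -- The reduced numerator has the degree belonging to `S`, so it is realized by simplices with
  -- vertices in `S`.
  rw [← MvPolynomial.mem_homogeneousSubmodule, ← hS.map_numerator] at hr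
  obtain ⟨c', hc', rfl⟩ := hr
  rw [← numerator_of_subset hSA hc', ← sub_eq_zero, ← map_sub,
    numerator_eq_zero_iff_simplexMeasure
      (Submodule.sub_mem _ hc (simplexChains_mono hSA hc')), map_sub, sub_eq_zero,
    hT.simplexMeasure_eq] at hr'
  exact ⟨c', hc', hr'.symm⟩

/-- The simplex by itself is a dissection, so it has no vertices outside `V`. -/
theorem IsSimplexVertexSet.mem_polytopes {S V : Finset (EuclideanSpace ℝ (Fin d))}
    (hV : IsSimplexVertexSet V) (hVS : V ⊆ S) :
    convexHull ℝ (V : Set (EuclideanSpace ℝ (Fin d))) ∈ polytopes S := by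
  refine ⟨⟨{V}, by simpa using hV.2, by simp⟩, fun v hv => ?_⟩
  obtain ⟨W, hW, hvW⟩ := hv {V} ⟨by simpa using hV, by simp, by
    simpa [openHull] using hV.closure_openHull⟩
  rw [Finset.mem_singleton] at hW
  exact hVS (hW ▸ hvW)

theorem map_simplexMeasure_le (S : Finset (EuclideanSpace ℝ (Fin d))) :
    (simplexChains S).map simplexMeasure ≤ simplexSpace S := by
  rintro _ ⟨c, hc, rfl⟩
  rw [simplexMeasure, Finsupp.linearCombination_apply]
  refine Submodule.sum_mem _ fun V hV => Submodule.smul_mem _ _ (Submodule.subset_span ?_)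
  obtain ⟨hV, hVS⟩ := mem_simplexChains.1 hc V hV
  exact ⟨_, ⟨hV.mem_polytopes hVS, V, hV, rfl⟩, rfl⟩

theorem StronglyNonDegenerate.polytopalSpace_eq {S : Finset (EuclideanSpace ℝ (Fin d))}
    (hS : StronglyNonDegenerate S) :
    polytopalSpace S = (simplexChains S).map simplexMeasure := by
  refine le_antisymm ?_ ((map_simplexMeasure_le S).trans (simplexSpace_le S))
  refine Submodule.span_le.2 ?_
  rintro _ ⟨P, hP, rfl⟩
  exact hS.standardMeasure_mem hP.2

theorem StronglyNonDegenerate.simplexSpace_eq {S : Finset (EuclideanSpace ℝ (Fin d))}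
    (hS : StronglyNonDegenerate S) : simplexSpace S = polytopalSpace S :=
  le_antisymm (simplexSpace_le S) (hS.polytopalSpace_eq.le.trans (map_simplexMeasure_le S))

/-! ### Dimension counts and injectivity of the Fantappie transform -/

/-- Both images are the quotient of `p` by the same kernel. This carries the dimension from
numerators over to measures. -/
theorem finrank_map_eq_of_forall_eq_zero_iff {K M N N' : Type*} [Field K] [AddCommGroup M]
    [Module K M] [AddCommGroup N] [Module K N] [AddCommGroup N'] [Module K N']
    (p : Submodule K M) (f : M →ₗ[K] N) (g : M →ₗ[K] N') (h : ∀ x ∈ p, f x = 0 ↔ g x = 0) :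
    Module.finrank K (p.map f) = Module.finrank K (p.map g) := by
  rw [← LinearMap.range_domRestrict, ← LinearMap.range_domRestrict]
  have hker : LinearMap.ker (f.domRestrict p) = LinearMap.ker (g.domRestrict p) := by
    ext x
    simpa using h x x.2
  exact (((f.domRestrict p).quotKerEquivRange.symm.trans (Submodule.quotEquivOfEq _ _ hker)).trans
    (g.domRestrict p).quotKerEquivRange).finrank_eq

theorem StronglyNonDegenerate.finrank_polytopalSpace {S : Finset (EuclideanSpace ℝ (Fin d))}
    (hS : StronglyNonDegenerate S) :
    Module.finrank ℝ (polytopalSpace S) = (S.card - (d + 1) + d).choose d := by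
  rw [hS.polytopalSpace_eq, ← finrank_homogeneousSubmodule, ← hS.map_numerator]
  exact finrank_map_eq_of_forall_eq_zero_iff _ _ _ fun c hc =>
    (numerator_eq_zero_iff_simplexMeasure hc).symm

theorem moment_standardMeasure (V : Finset (EuclideanSpace ℝ (Fin d))) (I : Fin d →₀ ℕ) :
    moment (standardMeasure (convexHull ℝ (V : Set (EuclideanSpace ℝ (Fin d))))) I =
      ∫ x in openHull V, monomialFun I x := by
  have hfin : IsFiniteMeasure (volume.restrict (openHull V)) :=
    isFiniteMeasure_restrict.2 (volume_interior_convexHull_ne_top V)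
  have hm : standardMeasure (convexHull ℝ (V : Set (EuclideanSpace ℝ (Fin d)))) =
      (volume.restrict (openHull V)).toSignedMeasure := by
    rw [standardMeasure_convexHull]
    ext s hs
    rw [withDensityᵥ_apply (integrable_indicator_openHull continuousOn_const) hs,
      Measure.toSignedMeasure_apply_measurable hs,
      integral_indicator (measurableSet_openHull V), Measure.restrict_restrict
      (measurableSet_openHull V), measureReal_restrict_apply hs, Set.inter_comm]
    simp
  -- Real multiplication is commutative; the flipped form is the one that matches
  -- `VectorMeasure.integral_toSignedMeasure`.
  have hB : ContinuousLinearMap.lsmul ℝ ℝ = (ContinuousLinearMap.lsmul ℝ ℝ).flip := by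
    ext
    simp
  rw [moment, hm, hB]
  exact VectorMeasure.integral_toSignedMeasure

theorem moment_simplexMeasure (c : Finset (EuclideanSpace ℝ (Fin d)) →₀ ℝ) (I : Fin d →₀ ℕ) :
    moment (simplexMeasure c) I = ∫ x, simplexFun c x * monomialFun I x := by
  have hi : ∀ V : Finset (EuclideanSpace ℝ (Fin d)),
      (c V • standardMeasure (convexHull ℝ (V : Set (EuclideanSpace ℝ (Fin d))))).Integrable
        (monomialFun I) := fun V =>
    (integrable_standardMeasure (isCompact_convexHull V) I).smul_vectorMeasure _
  rw [integral_simplexFun_mul fun V _ => (continuous_monomialFun I).continuousOn, moment,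
    simplexMeasure, Finsupp.linearCombination_apply, Finsupp.sum,
    VectorMeasure.integral_finsetSum_vectorMeasure fun V _ => hi V]
  refine Finset.sum_congr rfl fun V _ => ?_
  rw [VectorMeasure.integral_smul_vectorMeasure, smul_eq_mul, ← moment_standardMeasure, moment]

/-- Powers of ⟨x, u⟩ are combinations of monomials, so vanishing moments kill all their integrals.
-/
theorem simplexFun_ae_eq_zero_of_moment {A : Finset (EuclideanSpace ℝ (Fin d))}
    {c : Finset (EuclideanSpace ℝ (Fin d)) →₀ ℝ} (hc : c ∈ simplexChains A)
    (h : ∀ I, moment (simplexMeasure c) I = 0) : simplexFun c =ᵐ[volume] 0 := by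
  obtain ⟨R, -, hR⟩ := exists_norm_le A
  refine ae_eq_zero_of_forall_integral_inner_pow (measurable_simplexFun c)
    (integrable_simplexFun c) (simplexFun_eq_zero_of_norm_lt hc hR) fun u k => ?_
  let p : MvPolynomial (Fin d) ℝ := (∑ i, MvPolynomial.C (u i) * MvPolynomial.X i) ^ k
  have hp : ∀ x : EuclideanSpace ℝ (Fin d), simplexFun c x * inner ℝ x u ^ k =
      ∑ I ∈ p.support, p.coeff I * (simplexFun c x * monomialFun I x) := by
    intro x
    have h1 : inner ℝ x u ^ k = MvPolynomial.eval (fun i => x i) p := by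
      simp [p, PiLp.inner_apply]
    rw [h1, MvPolynomial.eval_eq', Finset.mul_sum]
    exact Finset.sum_congr rfl fun I _ => mul_left_comm _ _ _
  simp only [hp]
  rw [integral_finsetSum _ fun I _ => (integrable_simplexFun_mul fun V _ =>
    (continuous_monomialFun I).continuousOn).const_mul _]
  refine Finset.sum_eq_zero fun I _ => ?_
  rw [integral_const_mul, ← moment_simplexMeasure, h I, mul_zero]

theorem StronglyNonDegenerate.fantappie_injective {S : Finset (EuclideanSpace ℝ (Fin d))}
    (hS : StronglyNonDegenerate S) : Function.Injective (fantappie S) := by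
  refine (injective_iff_map_eq_zero _).2 fun μ hμ => ?_
  obtain ⟨c, hc, hcμ⟩ := hS.polytopalSpace_eq.le μ.2
  refine Subtype.ext ?_
  rw [← hcμ, ZeroMemClass.coe_zero, simplexMeasure_eq_zero_iff]
  refine simplexFun_ae_eq_zero_of_moment hc fun I => ?_
  rw [hcμ]
  -- The normalizing factor (|I| + d)! / I! is nonzero, so each coefficient of the transform
  -- determines its moment.
  refine (mul_eq_zero.1 (congrFun hμ I)).resolve_left ?_
  positivity

end PolytopalMeasure

end

theorem corollary1p11 (d : ℕ) (S : Finset (EuclideanSpace ℝ (Fin d)))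
    (hS : PolytopalMeasure.StronglyNonDegenerate S) :
    PolytopalMeasure.simplexSpace S = PolytopalMeasure.polytopalSpace S ∧
    Module.finrank ℝ (PolytopalMeasure.simplexSpace S) = (S.card - 1).choose d ∧
    Module.finrank ℝ (PolytopalMeasure.polytopalSpace S) = (S.card - 1).choose d ∧
    Module.finrank ℝ (PolytopalMeasure.simplexTransforms S) = (S.card - 1).choose d ∧
    Module.finrank ℝ (PolytopalMeasure.polytopalTransforms S) = (S.card - 1).choose d ∧
    Module.finrank ℝ (PolytopalMeasure.rationalSpace S) = (S.card - 1).choose d := by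
  have hcard := hS.1.card_ge
  have hnum : S.card - 1 = S.card - (d + 1) + d := by omega
  have hpoly := hS.finrank_polytopalSpace
  have hsimp : Module.finrank ℝ (PolytopalMeasure.simplexSpace S) =
      (S.card - (d + 1) + d).choose d := by rw [hS.simplexSpace_eq, hpoly]
  rw [hnum]
  refine ⟨hS.simplexSpace_eq, hsimp, hpoly, ?_, ?_, PolytopalMeasure.finrank_rationalSpace S⟩
  · rw [PolytopalMeasure.simplexTransforms, LinearMap.finrank_range_of_inj, hsimp]
    exact hS.fantappie_injective.comp (Submodule.inclusion_injective _)
  · rw [PolytopalMeasure.polytopalTransforms,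
      LinearMap.finrank_range_of_inj hS.fantappie_injective, hpoly]
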